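/- Conventions. Let $\mathsf T$ be a triangulated category with suspension $\Sigma$ and small coproducts, and $\mathsf T^c$ its full subcategory of compact objects. For full subcategories, $\mathsf A\star\mathsf C$ denotes the objects $B$ in a triangle $A\to B\to C\to\Sigma A$ with $A\in\mathsf A$, $C\in\mathsf C$; $\mathsf A^\perp=\{c:\operatorname{Hom}(\mathsf A,c)=0\}$ and ${}^\perp\mathsf A=\{c:\operatorname{Hom}(c,\mathsf A)=0\}$, taken in $\mathsf T$; $\operatorname{smd}$ is closure under direct summands; $\operatorname{coprod}(\mathsf U)$ is the closure of $\mathsf U$ under finite direct sums and extensions; $\operatorname{Coprod}_1(\mathsf U)$ consists of the small coproducts of objects of $\mathsf U$, and $\operatorname{Coprod}_{n+1}(\mathsf U)=\operatorname{Coprod}_1(\mathsf U)\star\operatorname{Coprod}_n(\mathsf U)$. For a sequence $\mathcal G=\{\mathcal G^n\}_{n\in\mathbb Z}$ of full subcategories of $\mathsf T^c$ and an interval $I$, put $\mathcal G^{I}=\operatorname{smd}(\operatorname{coprod}(\bigcup_{n\in I}\mathcal G^n))$ and $\overline{\mathcal G}{}^{I}_{A}=\operatorname{smd}(\operatorname{Coprod}_A(\bigcup_{n\in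 I}\mathcal G^n))$. If $\mathsf T$ is compactly generated, $\mathcal G$ is a *generating sequence* if $\mathcal G^{(-\infty,\infty)}=\mathsf T^c$ and $\Sigma^{-1}\mathcal G^n\cup\mathcal G^n\cup\Sigma\mathcal G^n\subseteq\mathcal G^{[n-1,n+1]}$ for all $n$; it is *finite* if each $\mathcal G^n$ has finitely many objects. Put $\mathcal M^{\mathcal G}_n=\mathcal G^{(-\infty,-n]}$, $\mathcal R^{\mathcal G}_n={}^\perp((\mathcal M^{\mathcal G}_n)^\perp)$, $$\overline{\mathsf T^c}=\bigcap_{n\in\mathbb Z}\mathsf T^c\star\mathcal R^{\mathcal G}_n,\qquad \mathsf T^b_c=\overline{\mathsf T^c}\cap\bigcup_{n\in\mathbb Z}(\mathcal M^{\mathcal G}_n)^\perp .$$ An *orthogonal metric* on $\mathsf T$ is a sequence $\{\mathcal R_n\}_{n\in\mathbb Z}$ of strictly full subcategories containing $0$ such that, for all $n$, $\mathcal R_n\star\mathcal R_n\subseteq\mathcal R_n$, $\Sigma^{-1}\mathcal R_{n+1}\cup\mathcal R_{n+1}\cup\Sigma\mathcal R_{n+1}\subseteq\mathcal R_n$ and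 ${}^\perp(\mathcal R_n^\perp)=\mathcal R_n$. A compactly generated $\mathsf T$ with a generating sequence $\mathcal G$ is *$\mathcal G$-quasiapproximable* if there are an orthogonal metric $\mathcal R$ on $\mathsf T$ and an integer $A>0$ such that (0) $\mathcal M^{\mathcal G}_i\subseteq\bigcup_{|n|\le A}\Sigma^n\mathcal M^{\mathcal G}_{i+1}$ for all $i\in\mathbb Z$; (1) $\mathcal M^{\mathcal G}_{i+A}\subseteq\mathcal R_i$ for all $i\in\mathbb Z$; (2) $\operatorname{Hom}(\mathcal G^n,\mathcal R_i)=0$ whenever $n+i\ge A$; (3) for all $i\in\mathbb Z$ and $F\in\mathcal R_i\cap\overline{\mathsf T^c}$ there is a triangle $E\to F\to D\to\Sigma E$ with $E\in\overline{\mathcal G}{}^{[-A-i,A-i]}_{A}$ and $D\in\mathcal R_{i+1}\cap\overline{\mathsf T^c}$. If $\mathsf T$ is $R$-linear, a *$\mathsf T^c$-cohomological functor* is an $R$-linear functor $H:[\mathsf T^c]^{\mathrm{op}}\to\operatorname{Mod}(R)$ such that $H(Z)\to H(Y)\to H(X)$ is exact for every triangle $X\to Y\to Z\to\Sigma X$ in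 $\mathsf T^c$; it is *$\mathcal G$-finite* if $H(K)$ is a finitely generated $R$-module for all $K\in\mathsf T^c$ and $H(\mathcal G^i)=0$ for $|i|\gg0$. **Theorem.** Let $R$ be a commutative noetherian ring and $\mathsf T$ an $R$-linear triangulated category which is $\mathcal G$-quasiapproximable for a finite generating sequence $\mathcal G$, and assume that $\operatorname{Hom}_{\mathsf T}(G,G')$ is a finitely generated $R$-module for all $G,G'\in\bigcup_{n\in\mathbb Z}\mathcal G^n$. Then the functor $\mathcal Y|_{\mathsf T^b_c}:\mathsf T^b_c\to\operatorname{Hom}([\mathsf T^c]^{\mathrm{op}},\operatorname{Mod}(R))$, $F\mapsto\operatorname{Hom}_{\mathsf T}(-,F)|_{\mathsf T^c}$, satisfies: (1) its essential image consists exactly of the $\mathcal G$-finite $\mathsf T^c$-cohomological functors; (2) it is fully faithful. -/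

import Mathlib

open CategoryTheory CategoryTheory.Limits CategoryTheory.Pretriangulated Opposite

universe w v u

namespace GApprox

section Triangulated

variable {T : Type u} [Category.{v} T] [HasZeroObject T] [HasShift T ℤ] [Preadditive T]
  [∀ n : ℤ, (shiftFunctor T n).Additive] [Pretriangulated T]

variable (T) in
/-- The compact objects `Tᶜ`: those `K` such that `Hom(K, -)`, as a functor to abelian groups,
preserves all small coproducts. -/
def compacts : ObjectProperty T :=
  fun K => ∀ J : Type v, PreservesColimitsOfShape (Discrete J) (preadditiveCoyoneda.obj (op K))

variable (T) in
/-- `T` has small coproducts, and a small set of compact objects generates `T`. -/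
structure IsCompactlyGenerated : Prop where
  hasCoproducts : HasCoproducts.{v} T
  exists_generators : ∃ S : ObjectProperty T, ObjectProperty.EssentiallySmall.{v} S ∧
    S ≤ compacts T ∧
    ∀ X : T, (∀ K : T, S K → ∀ (n : ℤ) (f : K⟦n⟧ ⟶ X), f = 0) → IsZero X

/-- `coprod(U)`: the closure of `U` under finite direct sums (the empty one included) and
extensions; it is closed under isomorphisms, as `sum` applies to families with one member. -/
inductive coprod (U : ObjectProperty T) : ObjectProperty T
  | of (X : T) (hX : U X) : coprod U X
  | sum {n : ℕ} (f : Fin n → T) (c : Cofan f) (hc : IsColimit c) (hf : ∀ i, coprod U (f i)) :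
      coprod U c.pt
  | ext (X Y Z : T) (a : X ⟶ Y) (b : Y ⟶ Z) (c : Z ⟶ X⟦(1 : ℤ)⟧)
      (h : Triangle.mk a b c ∈ distTriang T) (hX : coprod U X) (hZ : coprod U Z) : coprod U Y

/-- `Add(U)`: the small coproducts of objects of `U`. -/
def bigAdd (U : ObjectProperty T) : ObjectProperty T :=
  fun X => ∃ J : Type v, U.colimitsOfShape (Discrete J) X

/-- `Coprod_n(U)` for `n ≥ 1`: `Coprod_1(U) = Add(U)` and
`Coprod_{n+1}(U) = Coprod_1(U) ⋆ Coprod_n(U)`. (The value at `n = 0` is not used.) -/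
def bigCoprod (U : ObjectProperty T) (n : ℕ) : ObjectProperty T :=
  (bigAdd U).extensionProductIter (n - 1)

/-- The union of the `𝒢ⁿ` with `n` in a set `I` of integers. -/
def slice (G : ℤ → ObjectProperty T) (I : Set ℤ) : ObjectProperty T :=
  fun X => ∃ n ∈ I, G n X

/-- `𝒢ᴵ = smd(coprod(⋃_{n ∈ I} 𝒢ⁿ))`. In a triangulated category the direct summands of an object
are its retracts. -/
def small (G : ℤ → ObjectProperty T) (I : Set ℤ) : ObjectProperty T :=
  (coprod (slice G I)).retractClosure

/-- The big category `smd(Coprod_n(⋃_{m ∈ I} 𝒢ᵐ))`, for `n ≥ 1`. -/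
def big (G : ℤ → ObjectProperty T) (I : Set ℤ) (n : ℕ) : ObjectProperty T :=
  (bigCoprod (slice G I) n).retractClosure

/-- Generating sequences. -/
structure IsGeneratingSequence (G : ℤ → ObjectProperty T) : Prop where
  le_compacts : ∀ n, G n ≤ compacts T
  generates : small G Set.univ = compacts T
  shift_neg : ∀ (n : ℤ) (X : T), G n X → small G (Set.Icc (n - 1) (n + 1)) (X⟦(-1 : ℤ)⟧)
  self : ∀ (n : ℤ) (X : T), G n X → small G (Set.Icc (n - 1) (n + 1)) X
  shift_pos : ∀ (n : ℤ) (X : T), G n X → small G (Set.Icc (n - 1) (n + 1)) (X⟦(1 : ℤ)⟧)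

/-- Generating sequences such that each `𝒢ⁿ` has only finitely many objects. -/
structure IsFiniteGeneratingSequence (G : ℤ → ObjectProperty T) : Prop
    extends IsGeneratingSequence G where
  finite : ∀ n, {X : T | G n X}.Finite

/-- Extended good metrics on `T`. -/
structure IsExtendedGoodMetric (M : ℤ → ObjectProperty T) : Prop where
  isoClosed : ∀ n, (M n).IsClosedUnderIsomorphisms
  containsZero : ∀ n, (M n).ContainsZero
  ext : ∀ n, ObjectProperty.extensionProduct (M n) (M n) ≤ M n
  shift_neg : ∀ (n : ℤ) (X : T), M (n + 1) X → M n (X⟦(-1 : ℤ)⟧)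
  anti : ∀ (n : ℤ) (X : T), M (n + 1) X → M n X
  shift_pos : ∀ (n : ℤ) (X : T), M (n + 1) X → M n (X⟦(1 : ℤ)⟧)

/-- Orthogonal metrics on `T`. -/
structure IsOrthogonalMetric (M : ℤ → ObjectProperty T) : Prop
    extends IsExtendedGoodMetric M where
  orthogonal : ∀ n, (M n).rightOrthogonal.leftOrthogonal = M n

/-- The metric on the compact objects attached to `𝒢`: its `n`-th term is `𝒢^{(-∞, -n]}`. -/
def metricM (G : ℤ → ObjectProperty T) (n : ℤ) : ObjectProperty T :=
  small G (Set.Iic (-n))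

/-- The orthogonal metric on `T` attached to `𝒢`, with orthogonals taken in `T`. -/
def metricR (G : ℤ → ObjectProperty T) (n : ℤ) : ObjectProperty T :=
  (metricM G n).rightOrthogonal.leftOrthogonal

/-- The closure of the compacts, computed with respect to the metric `metricR G`. -/
def closureCompacts (G : ℤ → ObjectProperty T) : ObjectProperty T :=
  fun X => ∀ n : ℤ, ObjectProperty.extensionProduct (compacts T) (metricR G n) X

/-- `T^b_c`: the objects of the closure of the compacts which are right orthogonal to some term
of the metric `metricM G`. -/
def boundedClosure (G : ℤ → ObjectProperty T) : ObjectProperty T :=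
  fun X => closureCompacts G X ∧ ∃ n : ℤ, (metricM G n).rightOrthogonal X

/-- The conditions of `𝒢`-preapproximability for an orthogonal metric `M` and an integer `A`. -/
structure IsPreapproximableWith (G M : ℤ → ObjectProperty T) (A : ℕ) : Prop where
  shift : ∀ (i : ℤ) (X : T), metricM G i X →
    ∃ n : ℤ, |n| ≤ A ∧ ∃ Y : T, metricM G (i + 1) Y ∧ Nonempty (X ≅ Y⟦n⟧)
  le : ∀ i : ℤ, metricM G (i + A) ≤ M i
  eventually_orthogonal : ∀ n : ℤ, ∃ N : ℤ, ∀ i ≥ N, M i ≤ (G n).rightOrthogonal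

/-- `𝒢`-quasiapproximability of `T`, for a generating sequence `𝒢`. -/
structure IsQuasiapproximable (G : ℤ → ObjectProperty T) : Prop where
  compactlyGenerated : IsCompactlyGenerated T
  generatingSequence : IsGeneratingSequence G
  exists_metric : ∃ (M : ℤ → ObjectProperty T) (A : ℕ), 0 < A ∧ IsOrthogonalMetric M ∧
    IsPreapproximableWith G M A ∧
    (∀ n i : ℤ, (A : ℤ) ≤ n + i → M i ≤ (G n).rightOrthogonal) ∧
    ∀ (i : ℤ) (F : T), M i F → closureCompacts G F →
      ∃ (E D : T) (a : E ⟶ F) (b : F ⟶ D) (c : D ⟶ E⟦(1 : ℤ)⟧),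
        Triangle.mk a b c ∈ distTriang T ∧ big G (Set.Icc (-A - i) (A - i)) A E ∧
          M (i + 1) D ∧ closureCompacts G D

variable {R : Type w} [CommRing R] [Linear R T]

/-- The `Tᶜ`-cohomological functors: the `R`-linear functors `(Tᶜ)ᵒᵖ ⥤ Mod(R)` which take the
triangles of `T` with compact vertices to exact sequences. -/
structure IsCohomological (H : (compacts T).FullSubcategoryᵒᵖ ⥤ ModuleCat.{v} R) : Prop where
  additive : H.Additive
  map_smul : ∀ {K L : (compacts T).FullSubcategory} (f : K ⟶ L) (r : R),
    H.map (r • f).op = r • H.map f.op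
  exact : ∀ (X Y Z : (compacts T).FullSubcategory) (a : X ⟶ Y) (b : Y ⟶ Z)
    (c : Z.obj ⟶ X.obj⟦(1 : ℤ)⟧), Triangle.mk a.hom b.hom c ∈ distTriang T →
    Function.Exact (H.map b.op).hom (H.map a.op).hom

/-- The `𝒢`-finite `Tᶜ`-cohomological functors. -/
structure IsGFinite (G : ℤ → ObjectProperty T)
    (H : (compacts T).FullSubcategoryᵒᵖ ⥤ ModuleCat.{v} R) : Prop extends IsCohomological H where
  finite : ∀ K : (compacts T).FullSubcategory, Module.Finite R (H.obj (op K))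
  bounded : ∃ N : ℤ, ∀ i : ℤ, N ≤ |i| → ∀ K : (compacts T).FullSubcategory, G i K.obj →
    Subsingleton (H.obj (op K))

variable (T R) in
/-- The restricted Yoneda functor `F ↦ Hom(-, F)|_{Tᶜ}`. -/
noncomputable def restrictedYoneda :
    T ⥤ (compacts T).FullSubcategoryᵒᵖ ⥤ ModuleCat.{v} R :=
  linearYoneda R T ⋙ (Functor.whiskeringLeft _ _ _).obj (compacts T).ι.op

variable (R) in
/-- The restriction of the restricted Yoneda functor to `T^b_c`. -/
noncomputable def restrictedYonedaBounded (G : ℤ → ObjectProperty T) :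
    (boundedClosure G).FullSubcategory ⥤ (compacts T).FullSubcategoryᵒᵖ ⥤ ModuleCat.{v} R :=
  (boundedClosure G).ι ⋙ restrictedYoneda T R

end Triangulated

end GApprox

/-!
An object `F` of the closure of the compacts has, for every `n`, a triangle `E ⟶ F ⟶ D ⟶ ΣE` with
`E` compact and `D` in `ℛₙ`. If `F'` is orthogonal to `ℳₘ`, then `D` and `Σ⁻¹D` are orthogonal to
`F'` for large `n`, so a map from `F` to `F'` is the same thing as a map from `E` to `F'`; as `E` is
compact, this is a value of the restricted Yoneda functor. Full faithfulness follows.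

A `𝒢`-finite cohomological functor `H` is represented by a homotopy colimit: as its values are
finitely generated and `R` is noetherian, `H` is a colimit of representable functors along a
sequence of compact objects, each term of which covers the values, and kills the relations, of `H`
at finitely many more objects. The representing object `F` is an extension of a shifted coproduct
of compacts by a coproduct of compacts, so composites of two compact-ghosts vanish on it. Attaching
compact objects to kill the maps to the cone of an approximation of `F` yields a ghost out of `F`
whose fibre, up to compact objects, lies in the metric; iterating past the length bound makes the
composite zero, so that `F` is a retract of the fibre.
-/

namespace GApprox

section Closure

open scoped ZeroObject

variable {T : Type u} [Category.{v} T] [HasZeroObject T] [HasShift T ℤ] [Preadditive T]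
  [∀ n : ℤ, (shiftFunctor T n).Additive] [Pretriangulated T]

/-- Properties of objects closed under zero objects, extensions and retracts. Unlike in a thick
subcategory, stability under shifts is not required: no term of a metric has it. -/
class IsExtRetractClosed (P : ObjectProperty T) : Prop
    extends P.ContainsZero, P.IsTriangulatedClosed₂, P.IsStableUnderRetracts

section

variable (P : ObjectProperty T) [P.IsTriangulatedClosed₂] [P.IsClosedUnderIsomorphisms]

variable [P.ContainsZero]

lemma isClosedUnderFiniteProducts_of_ext : P.IsClosedUnderFiniteProducts := by
  have : P.IsClosedUnderBinaryProducts :=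
    { limitsOfShape_le := by
        rintro X ⟨p⟩
        refine P.prop_of_iso ?_ (P.ext_of_isTriangulatedClosed₂ _
          (binaryProductTriangle_distinguished _ _)
          (p.prop_diag_obj (.mk .left)) (p.prop_diag_obj (.mk .right)))
        exact IsLimit.conePointUniqueUpToIso (prodIsProd _ _)
          ((IsLimit.postcomposeHomEquiv (diagramIsoPair p.diag) _).2 p.isLimit) }
  exact .mk'

lemma prop_of_isColimit_cofan {J : Type*} [Finite J] (f : J → T) (c : Cofan f)
    (hc : IsColimit c) (hf : ∀ j, P (f j)) : P c.pt := by
  have := isClosedUnderFiniteProducts_of_ext P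
  exact P.prop_of_iso ((biproduct.isoProduct f).symm ≪≫
    IsColimit.coconePointUniqueUpToIso (biproduct.isColimit f) hc) (P.prop_product hf)

lemma coprod_le {U : ObjectProperty T} (h : U ≤ P) : coprod U ≤ P := by
  intro X hX
  induction hX with
  | of X hX => exact h X hX
  | sum f c hc _ ih => exact prop_of_isColimit_cofan P f c hc ih
  | ext X Y Z a b c hT _ _ ihX ihZ => exact P.ext_of_isTriangulatedClosed₂ _ hT ihX ihZ

end

instance (U : ObjectProperty T) : (coprod U).IsClosedUnderIsomorphisms where
  of_iso {X Y} e hX := by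
    let c : Cofan (fun _ : Fin 1 => X) := Cofan.mk Y (fun _ => e.hom)
    exact coprod.sum _ c (Cofan.IsColimit.mk _ (fun s => e.inv ≫ s.inj 0)
      (fun s i => by fin_cases i; exact e.hom_inv_id_assoc _)
      (fun s m hm => by rw [← hm 0]; exact (e.inv_hom_id_assoc _).symm)) (fun _ => hX)

instance (U : ObjectProperty T) : (coprod U).ContainsZero where
  exists_zero := ⟨0, isZero_zero T, by
    let c : Cofan (fun i : Fin 0 => (i.elim0 : T)) := Cofan.mk 0 (fun i => i.elim0)
    exact coprod.sum _ c (Cofan.IsColimit.mk _ (fun s => 0) (fun s i => i.elim0)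
      (fun s m _ => (isZero_zero T).eq_of_src _ _)) (fun i => i.elim0)⟩

instance (U : ObjectProperty T) : (coprod U).IsTriangulatedClosed₂ :=
  .mk' (fun _ hT hX hZ => .ext _ _ _ _ _ _ hT hX hZ)

instance (P : ObjectProperty T) [P.ContainsZero] [P.IsTriangulatedClosed₂]
    [P.IsClosedUnderIsomorphisms] : IsExtRetractClosed P.retractClosure where
  toIsTriangulatedClosed₂ := .mk' (fun _ hT hX hZ =>
    ObjectProperty.monotone_retractClosure
      (P.extensionProduct_le_of_isTriangulatedClosed₂ le_rfl le_rfl) _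
      (P.extensionProduct_retractClosure_retractClosure_le P _ ⟨_, _, _, _, _, hT, hX, hZ⟩))

instance (P : ObjectProperty T) : IsExtRetractClosed P.leftOrthogonal where
  of_retract r hY W f hW := by
    rw [← Category.id_comp f, ← r.retract, Category.assoc, hY (r.r ≫ f) hW, comp_zero]

instance (P : ObjectProperty T) [IsExtRetractClosed P] (n : ℤ) :
    IsExtRetractClosed (P.shift n) where
  exists_zero := ⟨0, isZero_zero T, P.prop_of_isZero (Functor.map_isZero _ (isZero_zero T))⟩
  toIsTriangulatedClosed₂ := .mk' (fun _ hT hX hZ =>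
    P.ext_of_isTriangulatedClosed₂ _ (Triangle.shift_distinguished _ hT n) hX hZ)
  of_retract r hY := P.prop_of_retract (r.map (shiftFunctor T n)) hY

end Closure

section Slices

lemma setOf_slice {T : Type u} [Category.{v} T] (G : ℤ → ObjectProperty T) (I : Set ℤ) :
    {X | slice G I X} = ⋃ n ∈ I, {X | G n X} := by
  ext X
  simp [slice]

lemma slice_mono {T : Type u} [Category.{v} T] (G : ℤ → ObjectProperty T) {I J : Set ℤ}
    (h : I ⊆ J) : slice G I ≤ slice G J :=
  fun _ ⟨n, hn, hX⟩ => ⟨n, h hn, hX⟩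

variable {T : Type u} [Category.{v} T] [HasZeroObject T] [HasShift T ℤ] [Preadditive T]
  [∀ n : ℤ, (shiftFunctor T n).Additive] [Pretriangulated T] (G : ℤ → ObjectProperty T)

instance (I : Set ℤ) : IsExtRetractClosed (small G I) :=
  inferInstanceAs (IsExtRetractClosed (coprod (slice G I)).retractClosure)

lemma slice_le_small (I : Set ℤ) : slice G I ≤ small G I :=
  fun _ hX => ObjectProperty.le_retractClosure _ _ (.of _ hX)

lemma small_le {G : ℤ → ObjectProperty T} {I : Set ℤ} {P : ObjectProperty T}
    [IsExtRetractClosed P] (h : slice G I ≤ P) : small G I ≤ P :=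
  (ObjectProperty.retractClosure_le_iff _ _).2 (coprod_le P h)

lemma small_mono {I J : Set ℤ} (h : I ⊆ J) : small G I ≤ small G J :=
  small_le ((slice_mono G h).trans (slice_le_small G J))

lemma small_rightOrthogonal_iff (I : Set ℤ) (X : T) :
    (small G I).rightOrthogonal X ↔ ∀ n ∈ I, (G n).rightOrthogonal X := by
  constructor
  · intro h n hn K f hK
    exact h f (slice_le_small G I _ ⟨n, hn, hK⟩)
  · intro h K f hK
    have hle : slice G I ≤ ObjectProperty.leftOrthogonal (· = X) := by
      rintro L ⟨n, hn, hL⟩ _ g rfl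
      exact h n hn g hL
    exact small_le hle K hK f rfl

end Slices

section Metrics

variable {T : Type u} [Category.{v} T] [Preadditive T] [HasShift T ℤ]
  [∀ n : ℤ, (shiftFunctor T n).Additive]

/-- The adjunction between the shifts by opposite integers, as an isomorphism of groups of
morphisms. -/
noncomputable def shiftHomAddEquiv {a b : ℤ} (hab : a + b = 0) (X Y : T) :
    (X⟦a⟧ ⟶ Y) ≃+ (X ⟶ Y⟦b⟧) :=
  have : (shiftEquiv' T a b hab).functor.Additive :=
    inferInstanceAs (shiftFunctor T a).Additive
  (shiftEquiv' T a b hab).toAdjunction.homAddEquiv X Y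

lemma forall_shift_hom_eq_zero_iff {X Y : T} {a b : ℤ} (hab : a + b = 0) :
    (∀ f : X⟦a⟧ ⟶ Y, f = 0) ↔ ∀ f : X ⟶ Y⟦b⟧, f = 0 := by
  let e := shiftHomAddEquiv hab X Y
  exact ⟨fun h f => by rw [← e.apply_symm_apply f, h (e.symm f), map_zero],
    fun h f => by rw [← e.symm_apply_apply f, h (e f), map_zero]⟩

variable [HasZeroObject T] [Pretriangulated T] {G : ℤ → ObjectProperty T}

instance (n : ℤ) : IsExtRetractClosed (metricR G n) :=
  inferInstanceAs (IsExtRetractClosed (metricM G n).rightOrthogonal.leftOrthogonal)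

variable (G) in
lemma metricM_le_metricR (n : ℤ) : metricM G n ≤ metricR G n :=
  fun _ hX _ f hY => hY f hX

variable (G) in
lemma metricM_anti : Antitone (metricM G) :=
  fun _ _ h => small_mono G (Set.Iic_subset_Iic.2 (by lia))

variable (G) in
lemma metricM_rightOrthogonal_mono : Monotone fun n => (metricM G n).rightOrthogonal :=
  fun _ _ h _ hX _ f hK => hX f (metricM_anti G h _ hK)

variable (G) in
lemma metricR_anti : Antitone (metricR G) :=
  fun _ _ h _ hX _ f hY => hX f (metricM_rightOrthogonal_mono G h _ hY)

namespace IsGeneratingSequence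

lemma small_shift (hG : IsGeneratingSequence G) {n a : ℤ} (ha : |a| ≤ 1) {X : T}
    (hX : G n X) : small G (Set.Icc (n - 1) (n + 1)) (X⟦a⟧) := by
  obtain rfl | rfl | rfl : a = -1 ∨ a = 0 ∨ a = 1 := by grind
  · exact hG.shift_neg n X hX
  · exact (small G _).prop_of_iso ((shiftFunctorZero T ℤ).symm.app X) (hG.self n X hX)
  · exact hG.shift_pos n X hX

lemma metricM_rightOrthogonal_shift (hG : IsGeneratingSequence G) {n a : ℤ} (ha : |a| ≤ 1)
    {X : T} (hX : (metricM G n).rightOrthogonal X) :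
    (metricM G (n + 1)).rightOrthogonal (X⟦a⟧) := by
  refine (small_rightOrthogonal_iff G _ _).2 fun j hj K f hK => ?_
  refine (forall_shift_hom_eq_zero_iff (neg_add_cancel a)).1 (fun g => hX g ?_) f
  refine small_mono G (fun x hx => ?_) _ (hG.small_shift (by rwa [abs_neg]) hK)
  simp only [Set.mem_Icc, Set.mem_Iic] at hj hx ⊢
  lia

lemma metricR_shift_of_abs_le_one (hG : IsGeneratingSequence G) {n a : ℤ} (ha : |a| ≤ 1) {X : T}
    (hX : metricR G (n + 1) X) : metricR G n (X⟦a⟧) := fun _ f hY =>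
  (forall_shift_hom_eq_zero_iff (add_neg_cancel a)).2
    (fun g => hX g (hG.metricM_rightOrthogonal_shift (by rwa [abs_neg]) hY)) f

lemma metricR_shift (hG : IsGeneratingSequence G) {n a m : ℤ} (h : m + |a| ≤ n) {X : T}
    (hX : metricR G n X) : metricR G m (X⟦a⟧) := by
  induction a generalizing m with
  | zero =>
    exact (metricR G m).prop_of_iso ((shiftFunctorZero T ℤ).symm.app X)
      (metricR_anti G (by simpa using h) _ hX)
  | succ k ih =>
    exact (metricR G m).prop_of_iso ((shiftFunctorAdd T (k : ℤ) 1).symm.app X)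
      (hG.metricR_shift_of_abs_le_one (by simp) (ih (by grind)))
  | pred k ih =>
    exact (metricR G m).prop_of_iso ((shiftFunctorAdd T (-k : ℤ) (-1)).symm.app X)
      (hG.metricR_shift_of_abs_le_one (by simp) (ih (by grind)))

end IsGeneratingSequence

end Metrics

section Compacts

variable {T : Type u} [Category.{v} T] [Preadditive T]

lemma preservesColimitsOfShape_discrete_of_compacts {K : T} (hK : compacts T K) (J : Type*)
    [Small.{v} J] :
    PreservesColimitsOfShape (Discrete J) (preadditiveCoyoneda.obj (op K)) :=
  have := hK (Shrink.{v} J)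
  preservesColimitsOfShape_of_equiv (Discrete.equivalence (equivShrink J).symm) _

lemma exists_finset_sum_of_compacts {K : T} (hK : compacts T K) {J : Type*} [Small.{v} J]
    {X : J → T} {c : Cofan X} (hc : IsColimit c) (f : K ⟶ c.pt) :
    ∃ (s : Finset J) (g : ∀ j, K ⟶ X j), f = ∑ j ∈ s, g j ≫ c.inj j := by
  have := preservesColimitsOfShape_discrete_of_compacts hK J
  let S : Submodule ℤ (K ⟶ c.pt) :=
    ⨆ j, LinearMap.range (Preadditive.rightComp K (c.inj j)).toIntLinearMap
  -- The quotient map by `S` vanishes on every summand of `Hom(K, ∐ X) = ⨁ Hom(K, X j)`.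
  have quotient_eq_zero : (AddCommGrpCat.ofHom S.mkQ.toAddMonoidHom :
      (preadditiveCoyoneda.obj (op K)).obj c.pt ⟶ AddCommGrpCat.of ((K ⟶ c.pt) ⧸ S)) = 0 := by
    refine (isColimitOfPreserves (preadditiveCoyoneda.obj (op K)) hc).hom_ext fun ⟨j⟩ => ?_
    ext g
    exact (Submodule.Quotient.mk_eq_zero S).2 (Submodule.mem_iSup_of_mem j ⟨g, rfl⟩)
  have hf : f ∈ S := (Submodule.Quotient.mk_eq_zero S).1
    (congrArg (fun φ => φ.hom f) quotient_eq_zero)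
  obtain ⟨y, hy, rfl⟩ := (Submodule.mem_iSup_iff_exists_finsupp _ _).1 hf
  choose g hg using hy
  exact ⟨y.support, g, Finset.sum_congr rfl fun j _ => (hg j).symm⟩

lemma eq_zero_of_comp_sigma_π {K : T} (hK : compacts T K) {J : Type*} [Small.{v} J]
    [DecidableEq J] {X : J → T} [HasCoproduct X] (u : K ⟶ ∐ X)
    (h : ∀ j, u ≫ Sigma.π X j = 0) : u = 0 := by
  obtain ⟨s, g, hg⟩ : ∃ (s : Finset J) (g : ∀ j, K ⟶ X j), u = ∑ j ∈ s, g j ≫ Sigma.ι X j :=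
    exists_finset_sum_of_compacts hK (coproductIsCoproduct X) u
  rw [hg]
  refine Finset.sum_eq_zero fun j hj => ?_
  have hgj := h j
  rw [hg, Preadditive.sum_comp, Finset.sum_eq_single_of_mem j hj fun i _ hi => by
    rw [Category.assoc, Sigma.ι_π_of_ne _ hi, comp_zero], Category.assoc, Sigma.ι_π_eq_id,
    Category.comp_id] at hgj
  rw [hgj, zero_comp]

variable [HasShift T ℤ] [∀ n : ℤ, (shiftFunctor T n).Additive]

/-- The functor represented by a shift is the shift of the represented functor. -/
noncomputable def preadditiveCoyonedaShiftIso (K : T) (n : ℤ) :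
    preadditiveCoyoneda.obj (op (K⟦n⟧)) ≅
      shiftFunctor T (-n) ⋙ preadditiveCoyoneda.obj (op K) :=
  NatIso.ofComponents (fun X => (shiftHomAddEquiv (add_neg_cancel n) K X).toAddCommGrpIso)
    (fun f => by
      ext g
      exact (shiftEquiv' T n (-n) (add_neg_cancel n)).toAdjunction.homEquiv_naturality_right g f)

instance : (compacts T).IsStableUnderShift ℤ where
  isStableUnderShiftBy n := ⟨fun K hK J =>
    have := hK J
    preservesColimitsOfShape_of_natIso (preadditiveCoyonedaShiftIso K n).symm⟩

variable [HasZeroObject T] [Pretriangulated T] {G : ℤ → ObjectProperty T}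

namespace IsGeneratingSequence

lemma isExtRetractClosed_compacts (hG : IsGeneratingSequence G) :
    IsExtRetractClosed (compacts T) :=
  hG.generates ▸ inferInstance

lemma small_le_compacts (hG : IsGeneratingSequence G) (I : Set ℤ) :
    small G I ≤ compacts T :=
  hG.generates ▸ small_mono G (Set.subset_univ I)

lemma compacts_cone (hG : IsGeneratingSequence G) {X Y Z : T}
    {a : X ⟶ Y} {b : Y ⟶ Z} {c : Z ⟶ X⟦(1 : ℤ)⟧} (h : Triangle.mk a b c ∈ distTriang T)
    (hX : compacts T X) (hY : compacts T Y) : compacts T Z :=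
  have := hG.isExtRetractClosed_compacts
  (compacts T).ext_of_isTriangulatedClosed₂ _ (rot_of_distTriang _ h) hY
    ((compacts T).le_shift 1 _ hX)

lemma exists_small_Icc (hG : IsGeneratingSequence G) {X : T} (hX : compacts T X) :
    ∃ n : ℕ, small G (Set.Icc (-(n : ℤ)) n) X := by
  let P : ObjectProperty T := fun X => ∃ n : ℕ, small G (Set.Icc (-(n : ℤ)) n) X
  have mono {m n : ℕ} (h : m ≤ n) :
      small G (Set.Icc (-(m : ℤ)) m) ≤ small G (Set.Icc (-(n : ℤ)) n) :=
    small_mono G (Set.Icc_subset_Icc (by lia) (by lia))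
  have : P.IsStableUnderRetracts := ⟨fun r ⟨n, hn⟩ => ⟨n, (small G _).prop_of_retract r hn⟩⟩
  have : IsExtRetractClosed P :=
    { exists_zero := by
        obtain ⟨Z, hZ, h⟩ :=
          (small G (Set.Icc (-((0 : ℕ) : ℤ)) (0 : ℕ))).exists_prop_of_containsZero
        exact ⟨Z, hZ, 0, h⟩
      toIsTriangulatedClosed₂ := .mk' fun _ hT ⟨m, hm⟩ ⟨n, hn⟩ =>
        ⟨max m n, (small G _).ext_of_isTriangulatedClosed₂ _ hT (mono (le_max_left m n) _ hm)
          (mono (le_max_right m n) _ hn)⟩ }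
  refine small_le (I := Set.univ) (P := P) ?_ X (hG.generates ▸ hX)
  rintro Y ⟨m, _, hY⟩
  exact ⟨m.natAbs, slice_le_small G _ _ ⟨m, by simp only [Set.mem_Icc]; lia, hY⟩⟩

end IsGeneratingSequence

end Compacts

section Telescope

variable {T : Type u} [Category.{v} T] [Preadditive T] (S : ℕ ⥤ T)
  [HasColimitsOfShape (Discrete ℕ) T]

/-- The map `1 - shift` on the coproduct of the terms of a sequence. The third vertices of its
triangles are the homotopy colimits of the sequence. -/
noncomputable def telescope : (∐ S.obj) ⟶ (∐ S.obj) :=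
  Sigma.desc (fun n => Sigma.ι S.obj n - S.map (homOfLE n.le_succ) ≫ Sigma.ι S.obj (n + 1))

lemma ι_telescope (n : ℕ) : Sigma.ι S.obj n ≫ telescope S =
    Sigma.ι S.obj n - S.map (homOfLE n.le_succ) ≫ Sigma.ι S.obj (n + 1) := by
  simp [telescope]

lemma telescope_π_zero : telescope S ≫ Sigma.π S.obj 0 = Sigma.π S.obj 0 :=
  Sigma.hom_ext _ _ fun n => by
    rw [reassoc_of% ι_telescope S, Preadditive.sub_comp, Category.assoc,
      Sigma.ι_π_of_ne _ (Nat.succ_ne_zero n), comp_zero, sub_zero]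

lemma telescope_π_succ (b : ℕ) : telescope S ≫ Sigma.π S.obj (b + 1) =
    Sigma.π S.obj (b + 1) - Sigma.π S.obj b ≫ S.map (homOfLE b.le_succ) :=
  Sigma.hom_ext _ _ fun n => by
    rw [reassoc_of% ι_telescope S, Preadditive.sub_comp, Preadditive.comp_sub, Category.assoc]
    congr 1
    by_cases h : n = b
    · subst h
      rw [Sigma.ι_π_eq_id, Sigma.ι_π_eq_id_assoc, Category.comp_id]
    · rw [Sigma.ι_π_of_ne _ (by lia), Sigma.ι_π_of_ne_assoc _ h, comp_zero, zero_comp]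

variable {S} {K : T} {x : K ⟶ ∐ S.obj}

lemma comp_π_eq_of_comp_telescope_eq {n : ℕ} {g : K ⟶ S.obj n}
    (hx : x ≫ telescope S = g ≫ Sigma.ι S.obj n) :
    (∀ b < n, x ≫ Sigma.π S.obj b = 0) ∧
      ∀ b (hb : n ≤ b), x ≫ Sigma.π S.obj b = g ≫ S.map (homOfLE hb) := by
  have zero : x ≫ Sigma.π S.obj 0 = g ≫ Sigma.ι S.obj n ≫ Sigma.π S.obj 0 := by
    rw [← reassoc_of% hx, telescope_π_zero]
  have succ (b : ℕ) : x ≫ Sigma.π S.obj (b + 1) = g ≫ Sigma.ι S.obj n ≫ Sigma.π S.obj (b + 1) +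
      (x ≫ Sigma.π S.obj b) ≫ S.map (homOfLE b.le_succ) := by
    rw [← reassoc_of% hx, telescope_π_succ, Preadditive.comp_sub, Category.assoc, sub_add_cancel]
  have low (b : ℕ) (hb : b < n) : x ≫ Sigma.π S.obj b = 0 := by
    induction b with
    | zero => rw [zero, Sigma.ι_π_of_ne _ hb.ne', comp_zero]
    | succ b ih =>
      rw [succ, ih (by lia), Sigma.ι_π_of_ne _ hb.ne', comp_zero, zero_comp, add_zero]
  refine ⟨low, fun b hb => ?_⟩
  induction b, hb using Nat.le_induction with
  | base =>
    cases n with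
    | zero => simp [zero]
    | succ k =>
      rw [succ, low k k.lt_succ_self, Sigma.ι_π_eq_id, zero_comp, add_zero]
      simp
  | succ b hb ih =>
    rw [succ, ih, Sigma.ι_π_of_ne _ (by lia), comp_zero, zero_add, Category.assoc, ← S.map_comp,
      homOfLE_comp]

lemma eq_zero_of_comp_telescope_eq_zero (hK : compacts T K) (hx : x ≫ telescope S = 0) :
    x = 0 :=
  eq_zero_of_comp_sigma_π hK x fun b => by
    rw [(comp_π_eq_of_comp_telescope_eq (n := 0) (g := 0) (hx.trans zero_comp.symm)).2 b b.zero_le,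
      zero_comp]

lemma exists_telescope_comp_eq {B : T}
    (hS : ∀ (n : ℕ) (f : S.obj n ⟶ B),
      ∃ g : S.obj (n + 1) ⟶ B, S.map (homOfLE n.le_succ) ≫ g = f)
    (f₀ : S.obj 0 ⟶ B) (k : (∐ S.obj) ⟶ B) :
    ∃ φ : (∐ S.obj) ⟶ B, Sigma.ι S.obj 0 ≫ φ = f₀ ∧ telescope S ≫ φ = k := by
  choose e he using hS
  let φ (n : ℕ) : S.obj n ⟶ B :=
    Nat.rec (motive := fun n => S.obj n ⟶ B) f₀ (fun n g => e n (g - Sigma.ι S.obj n ≫ k)) n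
  have φ_succ (n : ℕ) : S.map (homOfLE n.le_succ) ≫ φ (n + 1) = φ n - Sigma.ι S.obj n ≫ k :=
    he _ _
  refine ⟨Sigma.desc φ, Sigma.ι_desc _ _, Sigma.hom_ext _ _ fun n => ?_⟩
  rw [reassoc_of% ι_telescope S, Preadditive.sub_comp, Category.assoc, Sigma.ι_desc, Sigma.ι_desc,
    φ_succ, sub_sub_cancel]

end Telescope

section Hocolim

variable {T : Type u} [Category.{v} T] [HasZeroObject T] [HasShift T ℤ] [Preadditive T]
  [∀ n : ℤ, (shiftFunctor T n).Additive] [Pretriangulated T]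
  {S : ℕ ⥤ T} [HasColimitsOfShape (Discrete ℕ) T]
  {F : T} {π : (∐ S.obj) ⟶ F} {δ : F ⟶ (∐ S.obj)⟦(1 : ℤ)⟧} {K : T}

lemma map_ι_hocolim (h : Triangle.mk (telescope S) π δ ∈ distTriang T) {m n : ℕ} (hmn : m ≤ n) :
    S.map (homOfLE hmn) ≫ Sigma.ι S.obj n ≫ π = Sigma.ι S.obj m ≫ π := by
  have telescope_comp : telescope S ≫ π = 0 := comp_distTriang_mor_zero₁₂ _ h
  induction n, hmn using Nat.le_induction with
  | base => simp
  | succ n hmn ih =>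
    have step := Sigma.ι S.obj n ≫= telescope_comp
    rw [reassoc_of% ι_telescope S, Preadditive.sub_comp, comp_zero, sub_eq_zero,
      Category.assoc] at step
    rw [← homOfLE_comp hmn n.le_succ, S.map_comp, Category.assoc, ← step, ih]

lemma comp_hocolim_eq_zero (h : Triangle.mk (telescope S) π δ ∈ distTriang T)
    (hK : compacts T K) (f : K ⟶ F) : f ≫ δ = 0 := by
  let e := (shiftFunctorCompIsoId T (-1 : ℤ) 1 (neg_add_cancel 1)).app K
  obtain ⟨u, hu⟩ := (shiftFunctor T (1 : ℤ)).map_surjective (e.hom ≫ f ≫ δ)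
  have δ_comp : δ ≫ (telescope S)⟦(1 : ℤ)⟧' = 0 := comp_distTriang_mor_zero₃₁ _ h
  have u_eq_zero : u = 0 := by
    refine eq_zero_of_comp_telescope_eq_zero ((compacts T).le_shift (-1) _ hK)
      ((shiftFunctor T (1 : ℤ)).map_injective ?_)
    rw [Functor.map_comp, hu, Category.assoc, Category.assoc, δ_comp, comp_zero, comp_zero,
      Functor.map_zero]
  rwa [u_eq_zero, Functor.map_zero, eq_comm, Preadditive.IsIso.comp_left_eq_zero] at hu

lemma exists_factors_hocolim (h : Triangle.mk (telescope S) π δ ∈ distTriang T)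
    (hK : compacts T K) (f : K ⟶ F) :
    ∃ (n : ℕ) (g : K ⟶ S.obj n), f = g ≫ Sigma.ι S.obj n ≫ π := by
  obtain ⟨u, rfl⟩ : ∃ u : K ⟶ ∐ S.obj, f = u ≫ π :=
    Triangle.coyoneda_exact₃ _ h f (comp_hocolim_eq_zero h hK f)
  obtain ⟨s, g, hg⟩ : ∃ (s : Finset ℕ) (g : ∀ j, K ⟶ S.obj j),
      u = ∑ j ∈ s, g j ≫ Sigma.ι S.obj j :=
    exists_finset_sum_of_compacts hK (coproductIsCoproduct S.obj) u
  have le_sup (j : s) : j.1 ≤ s.sup id := Finset.le_sup (f := id) j.2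
  refine ⟨s.sup id, ∑ j ∈ s.attach, g j ≫ S.map (homOfLE (le_sup j)), ?_⟩
  rw [hg, ← Finset.sum_attach, Preadditive.sum_comp, Preadditive.sum_comp]
  exact Finset.sum_congr rfl fun j _ => by rw [Category.assoc, Category.assoc, map_ι_hocolim h]

lemma exists_comp_map_eq_zero_of_hocolim (h : Triangle.mk (telescope S) π δ ∈ distTriang T)
    (hK : compacts T K) {n : ℕ} (g : K ⟶ S.obj n) (hg : g ≫ Sigma.ι S.obj n ≫ π = 0) :
    ∃ (m : ℕ) (hm : n ≤ m), g ≫ S.map (homOfLE hm) = 0 := by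
  obtain ⟨x, hx⟩ : ∃ x : K ⟶ ∐ S.obj, g ≫ Sigma.ι S.obj n = x ≫ telescope S :=
    Triangle.coyoneda_exact₂ _ h _ ((Category.assoc _ _ _).trans hg)
  obtain ⟨s, y, hy⟩ : ∃ (s : Finset ℕ) (y : ∀ j, K ⟶ S.obj j),
      x = ∑ j ∈ s, y j ≫ Sigma.ι S.obj j :=
    exists_finset_sum_of_compacts hK (coproductIsCoproduct S.obj) x
  refine ⟨max n (s.sup id + 1), le_max_left _ _, ?_⟩
  rw [← (comp_π_eq_of_comp_telescope_eq hx.symm).2, hy, Preadditive.sum_comp]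
  refine Finset.sum_eq_zero fun j hj => ?_
  have : j ≤ s.sup id := Finset.le_sup (f := id) hj
  rw [Category.assoc, Sigma.ι_π_of_ne _ (by lia), comp_zero]

end Hocolim

section

lemma hasColimitsOfShape_discrete_of_small (C : Type*) [Category.{v} C] [HasCoproducts.{v} C]
    (J : Type*) [Small.{v} J] : HasColimitsOfShape (Discrete J) C :=
  hasColimitsOfShape_of_equivalence (Discrete.equivalence (equivShrink.{v} J).symm)

lemma exists_sequence {C : Type*} [Category* C] {P : ∀ (_ : ℕ) ⦃X Y : C⦄, (X ⟶ Y) → Prop}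
    (hP : ∀ n X, ∃ (Y : C) (t : X ⟶ Y), P n t) (X₀ : C) :
    ∃ S : ℕ ⥤ C, S.obj 0 = X₀ ∧ ∀ n : ℕ, P n (S.map (homOfLE n.le_succ)) := by
  choose Y t ht using hP
  let obj (n : ℕ) : C := Nat.rec X₀ (fun n Z => Y n Z) n
  let map (n : ℕ) : obj n ⟶ obj (n + 1) := t n (obj n)
  exact ⟨Functor.ofSequence map, rfl, fun n => by
    rw [Functor.ofSequence_map_homOfLE_succ map n]; exact ht _ _⟩

end

section Torsion

variable {T : Type u} [Category.{v} T] [HasZeroObject T] [HasShift T ℤ] [Preadditive T]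
  [∀ n : ℤ, (shiftFunctor T n).Additive] [Pretriangulated T]

/-- The maps `t` whose fibre is left orthogonal to `B`, in terms of the maps out of the source and
the target of `t`; see `fibreOrthogonal_iff`. This form passes to homotopy colimits. -/
def FibreOrthogonal (B : T) {Y Y' : T} (t : Y ⟶ Y') : Prop :=
  (∀ f : Y ⟶ B, ∃ g : Y' ⟶ B, t ≫ g = f) ∧ ∀ g : Y' ⟶ B⟦(1 : ℤ)⟧, t ≫ g = 0 → g = 0

lemma fibreOrthogonal_iff {B X Y Z : T} {a : X ⟶ Y} {b : Y ⟶ Z} {c : Z ⟶ X⟦(1 : ℤ)⟧}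
    (h : Triangle.mk a b c ∈ distTriang T) : FibreOrthogonal B b ↔ ∀ f : X ⟶ B, f = 0 := by
  have a_comp_b : a ≫ b = 0 := comp_distTriang_mor_zero₁₂ _ h
  have b_comp_c : b ≫ c = 0 := comp_distTriang_mor_zero₂₃ _ h
  constructor
  · rintro ⟨surj, inj⟩ f
    obtain ⟨g, hg⟩ : ∃ g : Y⟦(1 : ℤ)⟧ ⟶ B⟦(1 : ℤ)⟧, f⟦(1 : ℤ)⟧' = (-a⟦(1 : ℤ)⟧') ≫ g :=
      Triangle.yoneda_exact₂ _ (rot_of_distTriang _ (rot_of_distTriang _ h)) _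
        (inj (c ≫ f⟦(1 : ℤ)⟧') (by rw [reassoc_of% b_comp_c, zero_comp]))
    obtain ⟨g, rfl⟩ := (shiftFunctor T (1 : ℤ)).map_surjective g
    obtain ⟨k, rfl⟩ := surj g
    refine (shiftFunctor T (1 : ℤ)).map_injective ?_
    rw [hg, Preadditive.neg_comp, ← Functor.map_comp, reassoc_of% a_comp_b, zero_comp]
    simp
  · intro hX
    refine ⟨fun f => ?_, fun g hg => ?_⟩
    · obtain ⟨g, hg⟩ := Triangle.yoneda_exact₂ _ h f (hX _)
      exact ⟨g, hg.symm⟩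
    · obtain ⟨k, rfl⟩ : ∃ k : X⟦(1 : ℤ)⟧ ⟶ B⟦(1 : ℤ)⟧, g = c ≫ k :=
        Triangle.yoneda_exact₃ _ h g hg
      obtain ⟨k, rfl⟩ := (shiftFunctor T (1 : ℤ)).map_surjective k
      rw [hX k, Functor.map_zero, comp_zero]

lemma exists_comp_eq_zero_and_fibreOrthogonal [HasCoproducts.{v} T] (P : ObjectProperty T)
    [ObjectProperty.Small.{v} P] (Y : T) :
    ∃ (Y' : T) (t : Y ⟶ Y'), (∀ K, P K → ∀ f : K ⟶ Y, f ≫ t = 0) ∧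
      ∀ B, P.rightOrthogonal B → FibreOrthogonal B t := by
  let J := Σ K : Subtype P, (K.1 ⟶ Y)
  have := hasColimitsOfShape_discrete_of_small T J
  let p : (∐ fun j : J => j.1.1) ⟶ Y := Sigma.desc fun j => j.2
  obtain ⟨Y', t, d, h⟩ := distinguished_cocone_triangle p
  refine ⟨Y', t, fun K hK f => ?_, fun B hB => (fibreOrthogonal_iff h).2 fun f =>
    Sigma.hom_ext _ _ fun j => by rw [comp_zero]; exact hB _ j.1.2⟩
  have p_comp_t : p ≫ t = 0 := comp_distTriang_mor_zero₁₂ _ h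
  have f_eq : Sigma.ι (fun j : J => j.1.1) ⟨⟨K, hK⟩, f⟩ ≫ p = f := Sigma.ι_desc _ _
  rw [← f_eq, Category.assoc, p_comp_t, comp_zero]

lemma FibreOrthogonal.hocolim {S : ℕ ⥤ T} [HasColimitsOfShape (Discrete ℕ) T] {B F : T}
    {π : (∐ S.obj) ⟶ F} {δ : F ⟶ (∐ S.obj)⟦(1 : ℤ)⟧}
    (h : Triangle.mk (telescope S) π δ ∈ distTriang T)
    (hS : ∀ n : ℕ, FibreOrthogonal B (S.map (homOfLE n.le_succ))) :
    FibreOrthogonal B (Sigma.ι S.obj 0 ≫ π) := by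
  have extend := exists_telescope_comp_eq fun n => (hS n).1
  have δ_comp : δ ≫ (telescope S)⟦(1 : ℤ)⟧' = 0 := comp_distTriang_mor_zero₃₁ _ h
  refine ⟨fun f => ?_, fun g hg => ?_⟩
  · obtain ⟨φ, hφ₀, hφ⟩ := extend f 0
    obtain ⟨g, rfl⟩ : ∃ g : F ⟶ B, φ = π ≫ g := Triangle.yoneda_exact₂ _ h φ hφ
    exact ⟨g, (Category.assoc _ _ _).trans hφ₀⟩
  · have ι_comp (n : ℕ) : Sigma.ι S.obj n ≫ π ≫ g = 0 := by
      induction n with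
      | zero => rw [← Category.assoc, hg]
      | succ n ih => exact (hS n).2 _ (by rwa [reassoc_of% map_ι_hocolim h n.le_succ])
    obtain ⟨k, rfl⟩ : ∃ k : (∐ S.obj)⟦(1 : ℤ)⟧ ⟶ B⟦(1 : ℤ)⟧, g = δ ≫ k :=
      Triangle.yoneda_exact₃ _ h g (Sigma.hom_ext _ _ fun n =>
        (ι_comp n).trans comp_zero.symm)
    obtain ⟨k, rfl⟩ := (shiftFunctor T (1 : ℤ)).map_surjective k
    obtain ⟨φ, -, rfl⟩ := extend 0 k
    rw [Functor.map_comp, reassoc_of% δ_comp, zero_comp]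

theorem exists_torsion_triangle [HasCoproducts.{v} T] (P : ObjectProperty T)
    [ObjectProperty.Small.{v} P] (hP : P ≤ compacts T) (Y₀ : T) :
    ∃ (X Y : T) (a : X ⟶ Y₀) (b : Y₀ ⟶ Y) (c : Y ⟶ X⟦(1 : ℤ)⟧),
      Triangle.mk a b c ∈ distTriang T ∧ P.rightOrthogonal.leftOrthogonal X ∧
        P.rightOrthogonal Y := by
  have := hasColimitsOfShape_discrete_of_small T ℕ
  obtain ⟨S, rfl, hS⟩ := exists_sequence (fun _ => exists_comp_eq_zero_and_fibreOrthogonal P) Y₀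
  obtain ⟨Y, π, δ, h⟩ := distinguished_cocone_triangle (telescope S)
  obtain ⟨X, a, c, hX⟩ := distinguished_cocone_triangle₁ (Sigma.ι S.obj 0 ≫ π)
  refine ⟨X, Y, a, _, c, hX, fun B f hB => ?_, fun K f hK => ?_⟩
  · exact (fibreOrthogonal_iff hX).1 (.hocolim h fun n => (hS n).2 B hB) f
  · obtain ⟨n, g, rfl⟩ := exists_factors_hocolim h (hP K hK) f
    rw [← map_ι_hocolim h n.le_succ, reassoc_of% (hS n).1 K hK, zero_comp]

namespace IsFiniteGeneratingSequence

variable {G : ℤ → ObjectProperty T}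

lemma small_slice (hG : IsFiniteGeneratingSequence G) (I : Set ℤ) :
    ObjectProperty.Small.{v} (slice G I) := by
  have : Countable {X | slice G I X} :=
    setOf_slice G I ▸ I.to_countable.biUnion fun n _ => (hG.finite n).countable
  exact inferInstanceAs (_root_.Small.{v} {X | slice G I X})

lemma finite_slice (hG : IsFiniteGeneratingSequence G) {I : Set ℤ} (hI : I.Finite) :
    Set.Finite {X | slice G I X} :=
  setOf_slice G I ▸ hI.biUnion fun n _ => hG.finite n

lemma exists_metric_torsion_triangle [HasCoproducts.{v} T] (hG : IsFiniteGeneratingSequence G)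
    (n : ℤ) (Y₀ : T) :
    ∃ (X Y : T) (a : X ⟶ Y₀) (b : Y₀ ⟶ Y) (c : Y ⟶ X⟦(1 : ℤ)⟧),
      Triangle.mk a b c ∈ distTriang T ∧ metricR G n X ∧ (metricM G n).rightOrthogonal Y := by
  have := hG.small_slice (Set.Iic (-n))
  have orthogonal_eq :
      (slice G (Set.Iic (-n))).rightOrthogonal = (metricM G n).rightOrthogonal := by
    ext Y
    exact ⟨fun h => (small_rightOrthogonal_iff G _ Y).2 fun m hm K f hK => h f ⟨m, hm, hK⟩,
      fun h K f hK => h f (slice_le_small G _ K hK)⟩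
  have hle : slice G (Set.Iic (-n)) ≤ compacts T :=
    (slice_le_small G _).trans (hG.small_le_compacts _)
  rw [metricR, ← orthogonal_eq]
  exact exists_torsion_triangle _ hle Y₀

end IsFiniteGeneratingSequence

end Torsion

section Octahedra

variable {T : Type u} [Category.{v} T] [HasZeroObject T] [HasShift T ℤ] [Preadditive T]
  [∀ n : ℤ, (shiftFunctor T n).Additive] [Pretriangulated T] [IsTriangulated T]

lemma exists_cone_comp {X₁ X₂ X₃ Z₁₂ Z₂₃ : T} {f : X₁ ⟶ X₂} {v₁₂ : X₂ ⟶ Z₁₂}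
    {w₁₂ : Z₁₂ ⟶ X₁⟦(1 : ℤ)⟧} (h₁₂ : Triangle.mk f v₁₂ w₁₂ ∈ distTriang T)
    {g : X₂ ⟶ X₃} {v₂₃ : X₃ ⟶ Z₂₃} {w₂₃ : Z₂₃ ⟶ X₂⟦(1 : ℤ)⟧}
    (h₂₃ : Triangle.mk g v₂₃ w₂₃ ∈ distTriang T) :
    ∃ (Z : T) (b : X₃ ⟶ Z) (c : Z ⟶ X₁⟦(1 : ℤ)⟧) (p : Z₁₂ ⟶ Z) (q : Z ⟶ Z₂₃),
      Triangle.mk (f ≫ g) b c ∈ distTriang T ∧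
      Triangle.mk p q (w₂₃ ≫ v₁₂⟦(1 : ℤ)⟧') ∈ distTriang T := by
  obtain ⟨Z, b, c, h⟩ := distinguished_cocone_triangle (f ≫ g)
  let o := Triangulated.someOctahedron rfl h₁₂ h₂₃ h
  exact ⟨Z, b, c, o.m₁, o.m₃, h, o.mem⟩

lemma exists_fibre_comp {X₁ X₂ X₃ Z₁₂ Z₂₃ : T} {v₁₂ : Z₁₂ ⟶ X₁} {f : X₁ ⟶ X₂}
    {w₁₂ : X₂ ⟶ Z₁₂⟦(1 : ℤ)⟧} (h₁₂ : Triangle.mk v₁₂ f w₁₂ ∈ distTriang T)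
    {v₂₃ : Z₂₃ ⟶ X₂} {g : X₂ ⟶ X₃} {w₂₃ : X₃ ⟶ Z₂₃⟦(1 : ℤ)⟧}
    (h₂₃ : Triangle.mk v₂₃ g w₂₃ ∈ distTriang T) :
    ∃ (Z : T) (a : Z ⟶ X₁) (c : X₃ ⟶ Z⟦(1 : ℤ)⟧) (p : Z₁₂ ⟶ Z) (q : Z ⟶ Z₂₃),
      Triangle.mk a (f ≫ g) c ∈ distTriang T ∧
      Triangle.mk p q (v₂₃ ≫ w₁₂) ∈ distTriang T ∧ p ≫ a = v₁₂ := by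
  obtain ⟨Z, a, c, h⟩ := distinguished_cocone_triangle₁ (f ≫ g)
  let o := Triangulated.someOctahedron' rfl h₁₂ h₂₃ h
  exact ⟨Z, a, c, o.m₁, o.m₃, h, o.mem, o.comm₁⟩

/-- Part of the `3 × 3` lemma: both octahedra are over the diagonal of the square. -/
lemma exists_cone_map {E₁ E₂ E₃ X Y Z D₁ D₂ : T} {e : E₁ ⟶ E₂} {e' : E₂ ⟶ E₃}
    {e'' : E₃ ⟶ E₁⟦(1 : ℤ)⟧} (hE : Triangle.mk e e' e'' ∈ distTriang T)
    {a : X ⟶ Y} {b : Y ⟶ Z} {c : Z ⟶ X⟦(1 : ℤ)⟧} (hX : Triangle.mk a b c ∈ distTriang T)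
    {i₁ : E₁ ⟶ X} {p₁ : X ⟶ D₁} {q₁ : D₁ ⟶ E₁⟦(1 : ℤ)⟧} (h₁ : Triangle.mk i₁ p₁ q₁ ∈ distTriang T)
    {i₂ : E₂ ⟶ Y} {p₂ : Y ⟶ D₂} {q₂ : D₂ ⟶ E₂⟦(1 : ℤ)⟧} (h₂ : Triangle.mk i₂ p₂ q₂ ∈ distTriang T)
    (comm : e ≫ i₂ = i₁ ≫ a) :
    ∃ (D₃ : T) (i₃ : E₃ ⟶ Z) (p₃ : Z ⟶ D₃) (q₃ : D₃ ⟶ E₃⟦(1 : ℤ)⟧) (r : D₂ ⟶ D₃)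
      (s : D₃ ⟶ D₁⟦(1 : ℤ)⟧) (t : D₁⟦(1 : ℤ)⟧ ⟶ D₂⟦(1 : ℤ)⟧),
      Triangle.mk i₃ p₃ q₃ ∈ distTriang T ∧ Triangle.mk r s t ∈ distTriang T := by
  obtain ⟨V, b', c', hV⟩ := distinguished_cocone_triangle (e ≫ i₂)
  let o₁ := Triangulated.someOctahedron rfl hE h₂ hV
  let o₂ := Triangulated.someOctahedron comm.symm h₁ hX hV
  obtain ⟨D₃, p₃, q₃, r, s, h₃, h₄⟩ := exists_cone_comp o₁.mem (rot_of_distTriang _ o₂.mem)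
  exact ⟨D₃, _, p₃, q₃, r, s, _, h₃, h₄⟩

end Octahedra

section FiniteHom

variable {T : Type u} [Category.{v} T] [Preadditive T] (R : Type w) [CommRing R] [Linear R T]

/-- The objects `X` such that `Hom(K, X)` is a finitely generated `R`-module for all `K` in `P`. -/
def HomFiniteFrom (P : ObjectProperty T) : ObjectProperty T :=
  fun X => ∀ K : T, P K → Module.Finite R (K ⟶ X)

/-- The objects `K` such that `Hom(K, X)` is a finitely generated `R`-module for all `X` in `P`. -/
def HomFiniteTo (P : ObjectProperty T) : ObjectProperty T :=
  fun K => ∀ X : T, P X → Module.Finite R (K ⟶ X)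

variable {R} in
lemma le_homFiniteFrom_iff {P Q : ObjectProperty T} :
    P ≤ HomFiniteFrom R Q ↔ Q ≤ HomFiniteTo R P :=
  ⟨fun h K hK X hX => h X hX K hK, fun h X hX K hK => h K hK X hX⟩

variable [IsNoetherianRing R] [HasZeroObject T] [HasShift T ℤ]
  [∀ n : ℤ, (shiftFunctor T n).Additive] [Pretriangulated T]

instance (P : ObjectProperty T) : IsExtRetractClosed (HomFiniteFrom R P) :=
  have : (HomFiniteFrom R P).IsStableUnderRetracts :=
    ⟨fun r hY K hK => by
      have := hY K hK
      exact Module.Finite.of_injective (Linear.rightComp R K r.i) fun f g hfg => by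
        simpa using congrArg (· ≫ r.r) hfg⟩
  { exists_zero := ⟨_, isZero_zero T, fun K _ =>
      have : Subsingleton (K ⟶ _) := ⟨(isZero_zero T).eq_of_tgt⟩
      inferInstance⟩
    toIsTriangulatedClosed₂ := .mk' fun t hT hX hZ K hK => by
      have := hX K hK
      have := hZ K hK
      have : IsNoetherian R (K ⟶ t.obj₂) := isNoetherian_of_range_eq_ker
        (Linear.rightComp R K t.mor₁) (Linear.rightComp R K t.mor₂)
        (le_antisymm
          (by rintro _ ⟨g, rfl⟩; simp [comp_distTriang_mor_zero₁₂ _ hT])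
          fun f hf => (Triangle.coyoneda_exact₂ _ hT f hf).imp fun _ => Eq.symm)
      infer_instance }

instance (P : ObjectProperty T) : IsExtRetractClosed (HomFiniteTo R P) :=
  have : (HomFiniteTo R P).IsStableUnderRetracts :=
    ⟨fun r hY W hW => by
      have := hY W hW
      exact Module.Finite.of_injective (Linear.leftComp R W r.r) fun f g hfg => by
        simpa using congrArg (r.i ≫ ·) hfg⟩
  { exists_zero := ⟨_, isZero_zero T, fun W _ =>
      have : Subsingleton (_ ⟶ W) := ⟨(isZero_zero T).eq_of_src⟩
      inferInstance⟩
    toIsTriangulatedClosed₂ := .mk' fun t hT hX hZ W hW => by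
      have := hX W hW
      have := hZ W hW
      have : IsNoetherian R (t.obj₂ ⟶ W) := isNoetherian_of_range_eq_ker
        (Linear.leftComp R W t.mor₂) (Linear.leftComp R W t.mor₁)
        (le_antisymm
          (by rintro _ ⟨g, rfl⟩; simp [comp_distTriang_mor_zero₁₂_assoc _ hT])
          fun f hf => (Triangle.yoneda_exact₂ _ hT f hf).imp fun _ => Eq.symm)
      infer_instance }

variable {R} in
lemma small_le_homFiniteFrom_small {G : ℤ → ObjectProperty T} {I : Set ℤ}
    (h : slice G I ≤ HomFiniteFrom R (slice G I)) : small G I ≤ HomFiniteFrom R (small G I) :=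
  le_homFiniteFrom_iff.2 (small_le (le_homFiniteFrom_iff.1 (small_le h)))

end FiniteHom

section Presheaves

variable {C : Type*} [Category* C]

/-- The action of a presheaf of modules on morphisms, as a linear map. -/
def res {R : Type*} [Ring R] (H : Cᵒᵖ ⥤ ModuleCat R) {X Y : C} (f : X ⟶ Y) :
    H.obj (op Y) →ₗ[R] H.obj (op X) :=
  (H.map f.op).hom

section

variable {R : Type*} [Ring R] (H : Cᵒᵖ ⥤ ModuleCat R)

lemma res_id {X : C} (y : H.obj (op X)) : res H (𝟙 X) y = y := by
  simp [res]

lemma res_comp {X Y Z : C} (f : X ⟶ Y) (g : Y ⟶ Z) (z : H.obj (op Z)) :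
    res H (f ≫ g) z = res H f (res H g z) := by
  simp [res]

end

variable [Preadditive C] {R : Type*} [CommRing R] [Linear R C]

variable (R) in
/-- The `R`-linear presheaves. (Mathlib has no `R`-linear structure on an opposite category.) -/
class IsLinearPresheaf (H : Cᵒᵖ ⥤ ModuleCat R) : Prop extends H.Additive where
  map_smul {X Y : C} (f : X ⟶ Y) (r : R) : H.map (r • f).op = r • H.map f.op

instance (F : C) : IsLinearPresheaf R ((linearYoneda R C).obj F) where
  map_smul f r := by
    ext h
    exact Linear.smul_comp _ _ _ _ _ _

variable (H : Cᵒᵖ ⥤ ModuleCat R) [IsLinearPresheaf R H]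

/-- The natural transformation `Hom(-, Y) ⟶ H` given by an element of `H(Y)`. -/
def evalHom (X : C) {Y : C} (y : H.obj (op Y)) : (X ⟶ Y) →ₗ[R] H.obj (op X) where
  toFun f := res H f y
  map_add' f g := by simp [res, H.map_add]
  map_smul' r f := by simp [res, IsLinearPresheaf.map_smul (H := H)]

lemma res_zero {X Y : C} (y : H.obj (op Y)) : res H (0 : X ⟶ Y) y = 0 :=
  (evalHom H X y).map_zero

lemma res_ι_sum_res_π {J : Type*} [Fintype J] (Y : J → C) [HasBiproduct Y]
    (x : ∀ j, H.obj (op (Y j))) (j : J) :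
    res H (biproduct.ι Y j) (∑ k, res H (biproduct.π Y k) (x k)) = x j := by
  rw [map_sum, Finset.sum_eq_single j, ← res_comp, biproduct.ι_π_self, res_id]
  · intro k _ hk
    rw [← res_comp, biproduct.ι_π_ne _ hk.symm, res_zero]
  · simp

lemma exists_cover [HasFiniteBiproducts C] (N : ∀ X, Submodule R (H.obj (op X)))
    (hN : ∀ ⦃X Y : C⦄ (f : X ⟶ Y), N Y ≤ (N X).comap (res H f))
    {U Q : ObjectProperty C} [Q.IsClosedUnderFiniteProducts] (hUQ : U ≤ Q)
    (hU : Set.Finite {X | U X}) (hfg : ∀ X, U X → (N X).FG) :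
    ∃ (K : C) (y : H.obj (op K)), Q K ∧ y ∈ N K ∧
      ∀ X, U X → N X ≤ LinearMap.range (evalHom H X y) := by
  have : Finite (Subtype U) := hU
  choose S hS using fun X : Subtype U => hfg X X.2
  let _ : Fintype (Σ X : Subtype U, {x // x ∈ S X}) := Fintype.ofFinite _
  let Y (j : Σ X : Subtype U, {x // x ∈ S X}) : C := j.1
  refine ⟨⨁ Y, ∑ j, res H (biproduct.π Y j) j.2, ?_, ?_, fun X hX => ?_⟩
  · exact Q.prop_of_isLimit (biproduct.isLimit Y) fun j => hUQ _ j.as.1.2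
  · exact sum_mem fun j _ => hN _ ((hS j.1).le (Submodule.subset_span j.2.2))
  · rw [← hS ⟨X, hX⟩, Submodule.span_le]
    exact fun x hx =>
      ⟨biproduct.ι Y ⟨⟨X, hX⟩, x, hx⟩, res_ι_sum_res_π H Y (fun j => j.2.1) _⟩

end Presheaves

section BigSmall

variable {T : Type u} [Category.{v} T] [HasZeroObject T] [HasShift T ℤ] [Preadditive T]
  [∀ n : ℤ, (shiftFunctor T n).Additive] [Pretriangulated T]
  {R : Type w} [CommRing R] [Linear R T]

lemma exists_hom_cover {U : ObjectProperty T} (hU : Set.Finite {X | U X})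
    {F : T} (hF : HomFiniteFrom R U F) :
    ∃ (K : T) (k : K ⟶ F), coprod U K ∧ ∀ X, U X → ∀ f : X ⟶ F, ∃ t : X ⟶ K, t ≫ k = f := by
  have := isClosedUnderFiniteProducts_of_ext (coprod U)
  obtain ⟨K, k, hK, -, hk⟩ := exists_cover ((linearYoneda R T).obj F) (fun _ => ⊤) (by simp)
    (Q := coprod U) (fun X hX => .of X hX) hU (fun X hX => (hF X hX).fg_top)
  exact ⟨K, k, hK, fun X hX f => hk X hX (Submodule.mem_top (x := f))⟩

lemma exists_factors_of_bigAdd {U : ObjectProperty T} (hU : Set.Finite {X | U X}) {X F : T}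
    (hX : bigAdd U X) (hF : HomFiniteFrom R U F) (f : X ⟶ F) :
    ∃ (K : T) (p : X ⟶ K) (k : K ⟶ F), coprod U K ∧ p ≫ k = f := by
  obtain ⟨J, ⟨p⟩⟩ := hX
  obtain ⟨K, k, hK, hk⟩ := exists_hom_cover hU hF
  choose t ht using fun j => hk _ (p.prop_diag_obj j) (p.ι.app j ≫ f)
  refine ⟨K, p.isColimit.desc (Cocone.mk K (Discrete.natTrans t)), k, hK, ?_⟩
  refine p.isColimit.hom_ext fun j => ?_
  rw [← Category.assoc, p.isColimit.fac]
  exact ht j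

variable [IsTriangulated T]

/-- The part of `F` through which the first coproduct factors is split off, and the induction
hypothesis is applied to the cone. -/
lemma exists_factors_of_extensionProductIter_bigAdd [IsNoetherianRing R] {U : ObjectProperty T}
    (hU : Set.Finite {X | U X}) (hU' : U ≤ (HomFiniteFrom R U).shift (1 : ℤ)) (n : ℕ) {X F : T}
    (hX : (bigAdd U).extensionProductIter n X) (hF : HomFiniteFrom R U F) (f : X ⟶ F) :
    ∃ (K : T) (p : X ⟶ K) (k : K ⟶ F), coprod U K ∧ p ≫ k = f := by
  induction n generalizing X F with
  | zero => exact exists_factors_of_bigAdd hU hX hF f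
  | succ n ih =>
    rw [ObjectProperty.extensionProductIter_succ] at hX
    obtain ⟨X', X'', i, j, d, hT, hX', hX''⟩ := hX
    obtain ⟨K', p', k', hK', hp'⟩ := exists_factors_of_bigAdd hU hX' hF (i ≫ f)
    obtain ⟨F', c', d', hF'⟩ := distinguished_cocone_triangle k'
    have hk' : k' ≫ c' = 0 := comp_distTriang_mor_zero₁₂ _ hF'
    obtain ⟨f'', hf''⟩ : ∃ f'' : X'' ⟶ F', f ≫ c' = j ≫ f'' :=
      Triangle.yoneda_exact₂ _ hT (f ≫ c')
        (show i ≫ f ≫ c' = 0 by rw [← reassoc_of% hp', hk', comp_zero])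
    have hF'' : HomFiniteFrom R U F' :=
      (HomFiniteFrom R U).ext_of_isTriangulatedClosed₂ _ (rot_of_distTriang _ hF') hF
        (coprod_le _ hU' _ hK')
    obtain ⟨K'', p'', k'', hK'', hp''⟩ := ih hX'' hF'' f''
    obtain ⟨F'', c'', d'', hT''⟩ := distinguished_cocone_triangle k''
    have hk'' : k'' ≫ c'' = 0 := comp_distTriang_mor_zero₁₂ _ hT''
    obtain ⟨K, k, e, p, q, hK, hpq, -⟩ := exists_fibre_comp hF' hT''
    obtain ⟨l, hl⟩ : ∃ l : X ⟶ K, f = l ≫ k := Triangle.coyoneda_exact₂ _ hK f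
      (show f ≫ c' ≫ c'' = 0 by rw [reassoc_of% hf'', ← hp'', Category.assoc, hk'']; simp)
    exact ⟨K, l, k, .ext _ _ _ _ _ _ hpq hK' hK'', hl.symm⟩

lemma small_of_big [IsNoetherianRing R] {G : ℤ → ObjectProperty T} {I : Set ℤ}
    (hI : Set.Finite {X | slice G I X})
    (hI' : slice G I ≤ (HomFiniteFrom R (slice G I)).shift (1 : ℤ))
    {n : ℕ} {E : T} (hE : big G I n E) (hE' : HomFiniteFrom R (slice G I) E) : small G I E := by
  obtain ⟨X, hX, ⟨r⟩⟩ := hE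
  obtain ⟨K, p, k, hK, hp⟩ :=
    exists_factors_of_extensionProductIter_bigAdd hI hI' (n - 1) hX hE' r.r
  exact ⟨K, hK, ⟨⟨r.i ≫ p, k, by rw [Category.assoc, hp, r.retract]⟩⟩⟩

end BigSmall

section Ghosts

variable {T : Type u} [Category.{v} T] [Preadditive T]

/-- The maps which vanish on all maps from objects of `U`. -/
def IsGhost (U : ObjectProperty T) {X Y : T} (f : X ⟶ Y) : Prop :=
  ∀ K, U K → ∀ g : K ⟶ X, g ≫ f = 0

/-- The composites of `n` ghosts (any map, if `n = 0`). -/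
def GhostPow (U : ObjectProperty T) : ℕ → ∀ {X Y : T}, (X ⟶ Y) → Prop
  | 0, _, _, _ => True
  | n + 1, X, Y, φ => ∃ (Z : T) (g : X ⟶ Z) (h : Z ⟶ Y), IsGhost U g ∧ GhostPow U n h ∧ g ≫ h = φ

/-- The objects on which all composites of `n` ghosts vanish. -/
def Killed (U : ObjectProperty T) (n : ℕ) : ObjectProperty T :=
  fun E => ∀ ⦃X Y : T⦄ (φ : X ⟶ Y), GhostPow U n φ → ∀ f : E ⟶ X, f ≫ φ = 0

variable {U V : ObjectProperty T}

lemma GhostPow.anti (hUV : U ≤ V) {n : ℕ} {X Y : T} {φ : X ⟶ Y} (h : GhostPow V n φ) :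
    GhostPow U n φ := by
  induction n generalizing X with
  | zero => trivial
  | succ n ih =>
    obtain ⟨Z, g, k, hg, hk, rfl⟩ := h
    exact ⟨Z, g, k, fun K hK => hg K (hUV K hK), ih hk, rfl⟩

lemma GhostPow.exists_comp_eq {a b : ℕ} {X Z : T} {φ : X ⟶ Z} (hφ : GhostPow U (b + a) φ) :
    ∃ (Y : T) (f : X ⟶ Y) (g : Y ⟶ Z), GhostPow U a f ∧ GhostPow U b g ∧ f ≫ g = φ := by
  induction a generalizing X with
  | zero => exact ⟨X, 𝟙 X, φ, trivial, hφ, by simp⟩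
  | succ a ih =>
    obtain ⟨W, g, k, hg, hk, rfl⟩ := hφ
    obtain ⟨Y, f, g', hf, hg', rfl⟩ := ih hk
    exact ⟨Y, g ≫ f, g', ⟨W, g, f, hg, hf, rfl⟩, hg', by simp⟩

namespace Killed

lemma mono (hUV : U ≤ V) {n : ℕ} : Killed U n ≤ Killed V n :=
  fun _ hE _ _ φ hφ f => hE φ (hφ.anti hUV) f

lemma of_prop {K : T} (hK : U K) : Killed U 1 K := by
  rintro X Y _ ⟨Z, g, k, hg, -, rfl⟩ f
  rw [← Category.assoc, hg K hK, zero_comp]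

lemma of_isColimit_cofan {J : Type*} {X : J → T} {c : Cofan X} (hc : IsColimit c)
    (hX : ∀ j, U (X j)) : Killed U 1 c.pt := fun Y Z φ hφ f =>
  hc.hom_ext fun j => by rw [← Category.assoc, of_prop (hX j.as) φ hφ, comp_zero]

lemma of_bigAdd {X : T} (hX : bigAdd U X) : Killed U 1 X := by
  obtain ⟨J, ⟨p⟩⟩ := hX
  intro Y Z φ hφ f
  refine p.isColimit.hom_ext fun j => ?_
  rw [← Category.assoc, of_prop (p.prop_diag_obj j) φ hφ, comp_zero]

instance (n : ℕ) : (Killed U n).IsStableUnderRetracts where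
  of_retract r hY X Z φ hφ f := by
    rw [← Category.id_comp f, ← r.retract, Category.assoc, Category.assoc, ← Category.assoc r.r,
      hY φ hφ, comp_zero]

variable [HasZeroObject T] [HasShift T ℤ] [∀ n : ℤ, (shiftFunctor T n).Additive]
  [Pretriangulated T]

lemma ext {a b : ℕ} {X Y Z : T} {x : X ⟶ Y} {y : Y ⟶ Z} {z : Z ⟶ X⟦(1 : ℤ)⟧}
    (h : Triangle.mk x y z ∈ distTriang T) (hX : Killed U a X) (hZ : Killed U b Z) :
    Killed U (b + a) Y := by
  intro C D φ hφ f
  obtain ⟨E, g, k, hg, hk, rfl⟩ := hφ.exists_comp_eq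
  obtain ⟨l, hl⟩ : ∃ l : Z ⟶ E, f ≫ g = y ≫ l := Triangle.yoneda_exact₂ _ h (f ≫ g)
    (show x ≫ f ≫ g = 0 by rw [← Category.assoc, hX g hg])
  rw [reassoc_of% hl, hZ k hk, comp_zero]

lemma of_extensionProductIter {n : ℕ} {X : T}
    (hX : (GApprox.bigAdd U).extensionProductIter n X) : Killed U (n + 1) X := by
  induction n generalizing X with
  | zero => exact of_bigAdd hX
  | succ n ih =>
    rw [ObjectProperty.extensionProductIter_succ] at hX
    obtain ⟨X', X'', i, j, d, hT, hX', hX''⟩ := hX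
    exact ext hT (of_bigAdd hX') (ih hX'')

lemma of_big {G : ℤ → ObjectProperty T} {I : Set ℤ} {n : ℕ} (hn : 0 < n) {X : T}
    (hX : big G I n X) : Killed (slice G I) n X := by
  obtain ⟨Y, hY, ⟨r⟩⟩ := hX
  obtain ⟨n, rfl⟩ := Nat.exists_eq_succ_of_ne_zero hn.ne'
  exact (Killed _ _).prop_of_retract r (of_extensionProductIter hY)

end Killed

lemma exists_killed_of_small [HasZeroObject T] [HasShift T ℤ]
    [∀ n : ℤ, (shiftFunctor T n).Additive] [Pretriangulated T] {G : ℤ → ObjectProperty T}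
    {I : Set ℤ} {K : T} (hK : small G I K) : ∃ n, Killed (slice G I) n K := by
  let P : ObjectProperty T := fun K => ∃ n, Killed (slice G I) n K
  have : P.IsStableUnderRetracts := ⟨fun r ⟨n, hn⟩ => ⟨n, (Killed _ n).prop_of_retract r hn⟩⟩
  have : IsExtRetractClosed P :=
    { exists_zero := ⟨_, isZero_zero T, 0, fun _ _ _ _ _ => (isZero_zero T).eq_of_src _ _⟩
      toIsTriangulatedClosed₂ := .mk' fun _ hT ⟨a, ha⟩ ⟨b, hb⟩ => ⟨b + a, Killed.ext hT ha hb⟩ }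
  exact small_le (P := P) (fun _ hX => ⟨1, Killed.of_prop hX⟩) K hK

end Ghosts

section Quasiapproximable

variable {T : Type u} [Category.{v} T] [HasZeroObject T] [HasShift T ℤ] [Preadditive T]
  [∀ n : ℤ, (shiftFunctor T n).Additive] [Pretriangulated T]

/-- `𝒢`-quasiapproximability of `T`, with a chosen metric `M` and a chosen integer `A`, for a
finite generating sequence `𝒢`. -/
structure IsQuasiapproximableWith (G M : ℤ → ObjectProperty T) (A : ℕ) : Prop where
  generating : IsFiniteGeneratingSequence G
  metric : IsOrthogonalMetric M
  pos : 0 < A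
  preapproximable : IsPreapproximableWith G M A
  orth : ∀ n i : ℤ, (A : ℤ) ≤ n + i → M i ≤ (G n).rightOrthogonal
  approx : ∀ (i : ℤ) (F : T), M i F → closureCompacts G F →
    ∃ (E D : T) (a : E ⟶ F) (b : F ⟶ D) (c : D ⟶ E⟦(1 : ℤ)⟧),
      Triangle.mk a b c ∈ distTriang T ∧ big G (Set.Icc (-A - i) (A - i)) A E ∧
        M (i + 1) D ∧ closureCompacts G D

lemma IsFiniteGeneratingSequence.compacts_le_homFiniteFrom {R : Type w} [CommRing R]
    [IsNoetherianRing R] [Linear R T] {G : ℤ → ObjectProperty T}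
    (hG : IsFiniteGeneratingSequence G)
    (h : ∀ X Y : T, slice G Set.univ X → slice G Set.univ Y → Module.Finite R (X ⟶ Y)) :
    compacts T ≤ HomFiniteFrom R (compacts T) :=
  hG.generates ▸ small_le_homFiniteFrom_small fun Y hY X hX => h X Y hX hY

lemma compacts_le_closureCompacts (G : ℤ → ObjectProperty T) : compacts T ≤ closureCompacts G :=
  fun X hX n => (compacts T).le_extensionProduct_left (metricR G n) X hX

instance (G : ℤ → ObjectProperty T) : (closureCompacts G).IsClosedUnderIsomorphisms where
  of_iso e hX n := ObjectProperty.prop_of_iso _ e (hX n)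

lemma IsGeneratingSequence.isStableUnderShift_closureCompacts {G : ℤ → ObjectProperty T}
    (hG : IsGeneratingSequence G) : (closureCompacts G).IsStableUnderShift ℤ where
  isStableUnderShiftBy n := ⟨fun X hX m => by
    obtain ⟨E, D, a, b, c, hT, hE, hD⟩ := hX (m + |n|)
    exact ⟨_, _, _, _, _, Triangle.shift_distinguished _ hT n, (compacts T).le_shift n _ hE,
      hG.metricR_shift le_rfl hD⟩⟩

namespace IsQuasiapproximableWith

variable {G M : ℤ → ObjectProperty T} {A : ℕ} (h : IsQuasiapproximableWith G M A)

include h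

lemma isGeneratingSequence : IsGeneratingSequence G :=
  h.generating.toIsGeneratingSequence

lemma isExtRetractClosed (i : ℤ) : IsExtRetractClosed (M i) :=
  h.metric.orthogonal i ▸ inferInstance

lemma metric_anti : Antitone M :=
  antitone_int_of_succ_le fun n => h.metric.anti n

lemma metricR_le {i n : ℤ} (hn : i + A ≤ n) : metricR G n ≤ M i := by
  rw [← h.metric.orthogonal i]
  exact fun X hX Y f hY => metricR_anti G hn X hX f
    fun K g hK => hY g (h.preapproximable.le i K hK)

lemma le_rightOrthogonal_small {i m : ℤ} (hm : A - i ≤ m) :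
    M i ≤ (small G (Set.Ici m)).rightOrthogonal := fun X hX =>
  (small_rightOrthogonal_iff G _ X).2 fun n hn =>
    h.orth n i (by rw [Set.mem_Ici] at hn; lia) X hX

lemma eventually_hom_eq_zero {K : T} (hK : compacts T K) :
    ∃ N : ℤ, ∀ n ≥ N, ∀ X, metricR G n X → ∀ f : K ⟶ X, f = 0 := by
  obtain ⟨m, hm⟩ := h.isGeneratingSequence.exists_small_Icc hK
  refine ⟨2 * A + m, fun n hn X hX f => ?_⟩
  exact h.le_rightOrthogonal_small (i := n - A) (m := -m) (by lia) X
    (h.metricR_le (by lia) X hX) f (small_mono G Set.Icc_subset_Ici_self K hm)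

lemma exists_metric {X : T} (hX : closureCompacts G X) : ∃ i, M i X := by
  obtain ⟨E, D, a, b, c, hT, hE, hD⟩ := hX 0
  obtain ⟨m, hm⟩ := h.isGeneratingSequence.exists_small_Icc hE
  have := h.isExtRetractClosed (-m - A)
  have hE' : metricM G (-m - A + A) E :=
    small_mono G (Set.Icc_subset_Iic_self.trans (Set.Iic_subset_Iic.2 (by lia))) E hm
  exact ⟨-m - A, (M _).ext_of_isTriangulatedClosed₂ _ hT (h.preapproximable.le _ E hE')
    (h.metricR_le (by lia) D hD)⟩

lemma closureCompacts_le_homFiniteFrom {R : Type w} [CommRing R] [Linear R T]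
    (hfin : compacts T ≤ HomFiniteFrom R (compacts T)) :
    closureCompacts G ≤ HomFiniteFrom R (compacts T) := by
  intro X hX K hK
  obtain ⟨N, hN⟩ := h.eventually_hom_eq_zero hK
  obtain ⟨E, D, a, b, c, hT, hE, hD⟩ := hX N
  have := hfin E hE K hK
  refine Module.Finite.of_surjective (Linear.rightComp R K a) fun f => ?_
  exact (Triangle.coyoneda_exact₂ _ hT f (hN N le_rfl D hD _)).imp fun _ => Eq.symm

variable [IsTriangulated T]

lemma closureCompacts_cone {X Y Z : T} {a : X ⟶ Y} {b : Y ⟶ Z} {c : Z ⟶ X⟦(1 : ℤ)⟧}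
    (hT : Triangle.mk a b c ∈ distTriang T) (hX : closureCompacts G X)
    (hY : closureCompacts G Y) : closureCompacts G Z := by
  intro n
  obtain ⟨E₁, D₁, i₁, p₁, q₁, h₁, hE₁, hD₁⟩ := hX (n + 1)
  obtain ⟨N, hN⟩ := h.eventually_hom_eq_zero hE₁
  obtain ⟨E₂, D₂, i₂, p₂, q₂, h₂, hE₂, hD₂⟩ := hY (max n N)
  obtain ⟨e, he⟩ : ∃ e : E₁ ⟶ E₂, i₁ ≫ a = e ≫ i₂ :=
    Triangle.coyoneda_exact₂ _ h₂ _ (hN _ (le_max_right n N) D₂ hD₂ _)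
  obtain ⟨E₃, e', e'', hE⟩ := distinguished_cocone_triangle e
  obtain ⟨D₃, i₃, p₃, q₃, r, s, t, h₃, h₄⟩ := exists_cone_map hE hT h₁ h₂ he.symm
  refine ⟨E₃, D₃, i₃, p₃, q₃, h₃, h.isGeneratingSequence.compacts_cone hE hE₁ hE₂, ?_⟩
  exact (metricR G n).ext_of_isTriangulatedClosed₂ _ h₄
    (metricR_anti G (le_max_left n N) _ hD₂)
    (h.isGeneratingSequence.metricR_shift (by simp) hD₁)

lemma isTriangulated_closureCompacts : (closureCompacts G).IsTriangulated :=
  have := h.isGeneratingSequence.isStableUnderShift_closureCompacts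
  have : (closureCompacts G).IsTriangulatedClosed₃ :=
    .mk' fun _ hT hX hY => h.closureCompacts_cone hT hX hY
  have := h.isGeneratingSequence.isExtRetractClosed_compacts
  { exists_zero := ⟨_, isZero_zero T, compacts_le_closureCompacts G _
      ((compacts T).prop_of_isZero (isZero_zero T))⟩
    toIsTriangulatedClosed₂ := .of_isTriangulatedClosed₃ }

variable {R : Type w} [CommRing R] [IsNoetherianRing R] [Linear R T]
  (hfin : compacts T ≤ HomFiniteFrom R (compacts T))

include hfin

lemma exists_small_approx {i : ℤ} {F : T} (hF : M i F) (hF' : closureCompacts G F) :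
    ∃ (E D : T) (a : E ⟶ F) (b : F ⟶ D) (c : D ⟶ E⟦(1 : ℤ)⟧),
      Triangle.mk a b c ∈ distTriang T ∧ small G (Set.Icc (-A - i) (A - i)) E ∧
        Killed (slice G (Set.Icc (-A - i) (A - i))) A E ∧ M (i + 1) D ∧
        closureCompacts G D := by
  obtain ⟨E, D, a, b, c, hT, hE, hD, hD'⟩ := h.approx i F hF hF'
  have := h.isTriangulated_closureCompacts
  have slice_le : slice G (Set.Icc (-A - i) (A - i)) ≤ compacts T :=
    (slice_le_small G _).trans (h.isGeneratingSequence.small_le_compacts _)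
  have hE' : closureCompacts G E := (closureCompacts G).ext_of_isTriangulatedClosed₁ _ hT hF' hD'
  refine ⟨E, D, a, b, c, hT, small_of_big (R := R) ?_ ?_ hE ?_, .of_big h.pos hE, hD, hD'⟩
  · exact h.generating.finite_slice (Set.finite_Icc _ _)
  · exact fun X hX K hK => hfin _ ((compacts T).le_shift 1 _ (slice_le X hX)) K (slice_le K hK)
  · exact fun K hK => h.closureCompacts_le_homFiniteFrom hfin E hE' K (slice_le K hK)

lemma exists_iterated_approx {i : ℤ} {F : T} (hF : M i F) (hF' : closureCompacts G F) (l : ℕ) :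
    ∃ (E D : T) (a : E ⟶ F) (b : F ⟶ D) (c : D ⟶ E⟦(1 : ℤ)⟧),
      Triangle.mk a b c ∈ distTriang T ∧ small G (Set.Icc (-A - i - l) (A - i)) E ∧
        Killed (slice G (Set.Icc (-A - i - l) (A - i))) (A * (l + 1)) E ∧ M (i + l + 1) D ∧
        closureCompacts G D := by
  induction l with
  | zero => simpa using h.exists_small_approx hfin hF hF'
  | succ l ih =>
    obtain ⟨E, D, a, b, c, hT, hE, hk, hD, hD'⟩ := ih
    obtain ⟨E₂, D₂, a₂, b₂, c₂, hT₂, hE₂, hk₂, hD₂, hD₂'⟩ := h.exists_small_approx hfin hD hD'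
    obtain ⟨Z, z, d, p, q, hZ, hE', -⟩ := exists_fibre_comp hT hT₂
    have hI : Set.Icc (-A - i - l) (A - i) ⊆ Set.Icc (-A - i - ((l + 1 : ℕ) : ℤ)) (A - i) :=
      Set.Icc_subset_Icc (by lia) le_rfl
    have hI₂ : Set.Icc (-A - (i + l + 1)) (A - (i + l + 1)) ⊆
        Set.Icc (-A - i - ((l + 1 : ℕ) : ℤ)) (A - i) :=
      Set.Icc_subset_Icc (by lia) (by lia)
    refine ⟨Z, D₂, z, b ≫ b₂, d, hZ, ?_, ?_, ?_, hD₂'⟩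
    · exact (small G _).ext_of_isTriangulatedClosed₂ _ hE' (small_mono G hI _ hE)
        (small_mono G hI₂ _ hE₂)
    · rw [mul_add_one, add_comm (A * (l + 1)) A]
      exact .ext hE' (Killed.mono (slice_mono G hI) _ hk) (Killed.mono (slice_mono G hI₂) _ hk₂)
    · rwa [Nat.cast_add_one, ← add_assoc]

lemma exists_approx_Ici {F : T} (hF : closureCompacts G F) (l : ℤ) :
    ∃ (E D : T) (a : E ⟶ F) (b : F ⟶ D) (c : D ⟶ E⟦(1 : ℤ)⟧),
      Triangle.mk a b c ∈ distTriang T ∧ small G (Set.Ici (-A - l)) E ∧ M (l + 1) D ∧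
        closureCompacts G D := by
  obtain ⟨i, hi⟩ := h.exists_metric hF
  obtain ⟨k, hk⟩ := Int.le.dest (min_le_right i l)
  obtain ⟨E, D, a, b, c, hT, hE, -, hD, hD'⟩ :=
    h.exists_iterated_approx hfin (h.metric_anti (min_le_left i l) _ hi) hF k
  refine ⟨E, D, a, b, c, hT, small_mono G ?_ _ hE, hk ▸ hD, hD'⟩
  exact Set.Icc_subset_Ici_self.trans (Set.Ici_subset_Ici.2 (by lia))

/-- A map from `D` to an object of `(ℳ_{m-A})^⊥` factors through `ℛ_{m-A}` after restriction to a
compact object `K`; any map from `K` to `D` factors through an approximation of `D`. -/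
lemma metricR_of_metric {m : ℤ} {D : T} (hD : M m D) (hD' : closureCompacts G D) :
    metricR G (m - A) D := by
  intro B f hB
  obtain ⟨K, D', a, b, c, hT, hK, hDR⟩ := hD' (m - A)
  obtain ⟨n, hn⟩ := h.isGeneratingSequence.exists_small_Icc hK
  obtain ⟨l, hl⟩ : ∃ l : ℕ, (A : ℤ) - (m + l + 1) ≤ -n := ⟨(A - m + n).toNat, by lia⟩
  obtain ⟨E, D₁, a₁, b₁, c₁, hT₁, hE, -, hD₁, -⟩ := h.exists_iterated_approx hfin hD hD' l
  obtain ⟨g, rfl⟩ : ∃ g : K ⟶ E, a = g ≫ a₁ := Triangle.coyoneda_exact₂ _ hT₁ a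
    (h.le_rightOrthogonal_small hl D₁ hD₁ _ (small_mono G Set.Icc_subset_Ici_self K hn))
  have hf : a₁ ≫ f = 0 := hB _ (small_mono G
    (Set.Icc_subset_Iic_self.trans (Set.Iic_subset_Iic.2 (by lia))) E hE)
  obtain ⟨k, rfl⟩ : ∃ k : D' ⟶ B, f = b ≫ k := Triangle.yoneda_exact₂ _ hT f
    (show (g ≫ a₁) ≫ f = 0 by rw [Category.assoc, hf, comp_zero])
  rw [hDR k hB, comp_zero]

end IsQuasiapproximableWith

end Quasiapproximable

section Tower

variable {T : Type u} [Category.{v} T] [Preadditive T] [HasShift T ℤ]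

lemma Killed.coproduct_shift {U : ObjectProperty T} [U.IsStableUnderShift ℤ] {J : Type*}
    {X : J → T} [HasCoproduct X] (hX : ∀ j, U (X j)) (n : ℤ) : Killed U 1 ((∐ X)⟦n⟧) :=
  of_isColimit_cofan (isColimitCofanMkObjOfIsColimit (shiftFunctor T n) X _
    (coproductIsCoproduct X)) fun j => U.le_shift n _ (hX j)

variable [HasZeroObject T] [∀ n : ℤ, (shiftFunctor T n).Additive] [Pretriangulated T]

lemma Killed.hocolim {U : ObjectProperty T} [U.IsStableUnderShift ℤ] {S : ℕ ⥤ T}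
    [HasColimitsOfShape (Discrete ℕ) T] {F : T} {π : (∐ S.obj) ⟶ F} {δ : F ⟶ (∐ S.obj)⟦(1 : ℤ)⟧}
    (h : Triangle.mk (telescope S) π δ ∈ distTriang T) (hS : ∀ n, U (S.obj n)) : Killed U 2 F :=
  .ext (rot_of_distTriang _ h) (.of_isColimit_cofan (coproductIsCoproduct S.obj) hS)
    (.coproduct_shift hS 1)

/-- The maps out of `F` whose fibre has the property `P`. -/
def HasFibreIn (P : ObjectProperty T) {F C : T} (φ : F ⟶ C) : Prop :=
  ∃ (X : T) (p : X ⟶ F) (d : C ⟶ X⟦(1 : ℤ)⟧), Triangle.mk p φ d ∈ distTriang T ∧ P X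

lemma HasFibreIn.id {P : ObjectProperty T} [P.ContainsZero] [P.IsClosedUnderIsomorphisms] (F : T) :
    HasFibreIn P (𝟙 F) :=
  ⟨_, _, _, contractible_distinguished₁ F, P.prop_of_isZero (isZero_zero T)⟩

namespace IsQuasiapproximableWith

variable {G M : ℤ → ObjectProperty T} {A : ℕ} (h : IsQuasiapproximableWith G M A) {F : T} {N : ℤ}
  (hN : (small G (Set.Ici N)).rightOrthogonal F)

include h

include hN in
lemma rightOrthogonal_small_of_distTriang {P C : T} {p : P ⟶ F} {φ : F ⟶ C}
    {d : C ⟶ P⟦(1 : ℤ)⟧} (hT : Triangle.mk p φ d ∈ distTriang T) (hP : M (1 - A - N) P) :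
    (small G (Set.Ici (2 * A + N))).rightOrthogonal C := by
  intro K f hK
  have hP' : M (-A - N) (P⟦(1 : ℤ)⟧) :=
    h.metric.shift_pos _ P (by rwa [show -(A : ℤ) - N + 1 = 1 - A - N by ring])
  obtain ⟨g, rfl⟩ : ∃ g : K ⟶ F, f = g ≫ φ := Triangle.coyoneda_exact₃ _ hT f
    (h.le_rightOrthogonal_small (by lia) _ hP' (f ≫ d) hK)
  rw [hN g (small_mono G (Set.Ici_subset_Ici.2 (by lia)) K hK), zero_comp]

variable [IsTriangulated T] {R : Type w} [CommRing R] [IsNoetherianRing R] [Linear R T]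
  (hfin : compacts T ≤ HomFiniteFrom R (compacts T))

lemma hasFibreIn_of_comp {i : ℤ} {C C' : T} {φ : F ⟶ C} {ψ : C ⟶ C'}
    (hφ : HasFibreIn (closureCompacts G ⊓ M i) φ)
    (hφψ : HasFibreIn (closureCompacts G ⊓ M i) (φ ≫ ψ)) :
    HasFibreIn (closureCompacts G ⊓ M (i - 1)) ψ := by
  obtain ⟨P, p, d, hT, hP, hP'⟩ := hφ
  obtain ⟨Q, q, e, hT', hQ, hQ'⟩ := hφψ
  obtain ⟨Z, z, c, hZ⟩ := distinguished_cocone_triangle₁ ψ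
  let o := Triangulated.someOctahedron' rfl hT hZ hT'
  have := h.isTriangulated_closureCompacts
  have := h.isExtRetractClosed (i - 1)
  refine ⟨Z, z, c, hZ, (closureCompacts G).ext_of_isTriangulatedClosed₃ _ o.mem hP hQ,
    (M (i - 1)).ext_of_isTriangulatedClosed₂ _ (rot_of_distTriang _ o.mem)
      (h.metric_anti (by lia) _ hQ') (h.metric.shift_pos _ P (by rwa [sub_add_cancel]))⟩

include hfin

include hN in
lemma exists_factors_metric {P : T} (hP : closureCompacts G P) (p : P ⟶ F) :
    ∃ (P' : T) (q : P ⟶ P') (p' : P' ⟶ F),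
      q ≫ p' = p ∧ (closureCompacts G ⊓ M (1 - A - N)) P' := by
  obtain ⟨E, D, a, b, c, hT, hE, hD, hD'⟩ := h.exists_approx_Ici hfin hP (-A - N)
  obtain ⟨g, hg⟩ : ∃ g : D ⟶ F, p = b ≫ g := Triangle.yoneda_exact₂ _ hT p
    (hN _ (small_mono G (Set.Ici_subset_Ici.2 (by lia)) E hE))
  exact ⟨D, b, g, hg.symm, hD', by rwa [show 1 - (A : ℤ) - N = -A - N + 1 by ring]⟩

omit [IsTriangulated T] [IsNoetherianRing R] hfin in
lemma exists_compact_cover (hF : HomFiniteFrom R (compacts T) F)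
    (hN : (small G (Set.Ici N)).rightOrthogonal F) (m : ℤ) :
    ∃ (L : T) (k : L ⟶ F), compacts T L ∧
      ∀ K, slice G (Set.Ici m) K → ∀ f : K ⟶ F, ∃ l : K ⟶ L, l ≫ k = f := by
  have small_le : small G (Set.Icc m N) ≤ compacts T := h.isGeneratingSequence.small_le_compacts _
  obtain ⟨L, k, hL, hk⟩ := exists_hom_cover (R := R)
    (h.generating.finite_slice (Set.finite_Icc m N))
    (fun X hX => hF X (small_le X (slice_le_small G _ X hX)))
  refine ⟨L, k, small_le L (ObjectProperty.le_retractClosure _ L hL), ?_⟩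
  rintro K ⟨j, hj, hK⟩ f
  rcases le_total j N with hjN | hjN
  · exact hk K ⟨j, ⟨hj, hjN⟩, hK⟩ f
  · exact ⟨0, by rw [hN f (slice_le_small G _ K ⟨j, hjN, hK⟩), zero_comp]⟩

/-- The map `ψ` is the cone of a cover of `C` by a compact object, followed by the map which
replaces the resulting fibre over `F` by one in the metric. -/
lemma exists_ghost (hF : HomFiniteFrom R (compacts T) F)
    (hN : (small G (Set.Ici N)).rightOrthogonal F) (m : ℤ) {C : T} {φ : F ⟶ C}
    (hφ : HasFibreIn (closureCompacts G ⊓ M (1 - A - N)) φ) :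
    ∃ (C' : T) (ψ : C ⟶ C'), IsGhost (slice G (Set.Ici m)) ψ ∧
      HasFibreIn (closureCompacts G ⊓ M (1 - A - N)) (φ ≫ ψ) := by
  obtain ⟨P, p, d, hT, hP, hP'⟩ := hφ
  have := h.isTriangulated_closureCompacts
  have hC : HomFiniteFrom R (compacts T) C :=
    (HomFiniteFrom R _).ext_of_isTriangulatedClosed₂ _ (rot_of_distTriang _ hT) hF
      (h.closureCompacts_le_homFiniteFrom hfin _ ((closureCompacts G).le_shift 1 _ hP))
  obtain ⟨L, k, hL, hk⟩ :=
    h.exists_compact_cover hC (h.rightOrthogonal_small_of_distTriang hN hT hP') m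
  obtain ⟨C₁, b, e, hC₁⟩ := distinguished_cocone_triangle k
  have k_comp_b : k ≫ b = 0 := comp_distTriang_mor_zero₁₂ _ hC₁
  obtain ⟨Z, z, y, r, s, hZ, hPZ, -⟩ := exists_fibre_comp hT hC₁
  have hZ' : closureCompacts G Z :=
    (closureCompacts G).ext_of_isTriangulatedClosed₂ _ hPZ hP (compacts_le_closureCompacts G L hL)
  obtain ⟨P', q, p', rfl, hP''⟩ := h.exists_factors_metric hN hfin hZ' z
  obtain ⟨C', x, t, hC'⟩ := distinguished_cocone_triangle p'
  have p'_comp_x : p' ≫ x = 0 := comp_distTriang_mor_zero₁₂ _ hC'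
  obtain ⟨g, hg⟩ : ∃ g : C₁ ⟶ C', x = (φ ≫ b) ≫ g := Triangle.yoneda_exact₂ _ hZ x
    (show (q ≫ p') ≫ x = 0 by rw [Category.assoc, p'_comp_x, comp_zero])
  refine ⟨C', b ≫ g, fun K hK f => ?_, P', p', t, by rwa [← Category.assoc, ← hg], hP''⟩
  obtain ⟨l, rfl⟩ := hk K hK f
  rw [Category.assoc, reassoc_of% k_comp_b, zero_comp, comp_zero]

variable (hF : HomFiniteFrom R (compacts T) F)

include hF hN

lemma exists_ghostPow (m : ℤ) (n : ℕ) {C : T} {φ : F ⟶ C}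
    (hφ : HasFibreIn (closureCompacts G ⊓ M (1 - A - N)) φ) :
    ∃ (C' : T) (ψ : C ⟶ C'), GhostPow (slice G (Set.Ici m)) n ψ ∧
      HasFibreIn (closureCompacts G ⊓ M (1 - A - N)) (φ ≫ ψ) := by
  induction n generalizing C with
  | zero => exact ⟨C, 𝟙 C, trivial, by rwa [Category.comp_id]⟩
  | succ n ih =>
    obtain ⟨C₁, g, hg, hφ₁⟩ := h.exists_ghost hfin hF hN m hφ
    obtain ⟨C₂, k, hk, hφ₂⟩ := ih hφ₁
    exact ⟨C₂, g ≫ k, ⟨C₁, g, k, hg, hk, rfl⟩, by rwa [← Category.assoc]⟩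

omit hF hN in
lemma comp_ghostPow_eq_zero {i m m' : ℤ} {l : ℕ} (hm : A - (i + l + 1) ≤ m)
    (hm' : m' ≤ -A - i - l) {K Z C C' : T} (hK : small G (Set.Ici m) K)
    (hZ : (closureCompacts G ⊓ M i) Z) (g : K ⟶ Z) (z : Z ⟶ C) {ψ : C ⟶ C'}
    (hψ : GhostPow (slice G (Set.Ici m')) (A * (l + 1)) ψ) : g ≫ z ≫ ψ = 0 := by
  obtain ⟨E, D, a, b, c, hE, -, hEk, hD, -⟩ := h.exists_iterated_approx hfin hZ.2 hZ.1 l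
  have hI : Set.Icc (-A - i - l) (A - i) ⊆ Set.Ici m' :=
    Set.Icc_subset_Ici_self.trans (Set.Ici_subset_Ici.2 hm')
  obtain ⟨x, hx⟩ : ∃ x : D ⟶ C', z ≫ ψ = b ≫ x := Triangle.yoneda_exact₂ _ hE (z ≫ ψ)
    (show a ≫ z ≫ ψ = 0 by
      rw [← Category.assoc, hEk ψ (hψ.anti (slice_mono G hI))])
  rw [hx, ← Category.assoc, h.le_rightOrthogonal_small hm D hD (g ≫ b) hK, zero_comp]

/-- A map `f` from an object of `𝒢^{[m, ∞)}` to `C` is annihilated by some longer tower of ghosts,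
hence it factors through the fibre of the composite, which is in the metric. -/
lemma exists_annihilates_small (m : ℤ) {C : T} {φ : F ⟶ C}
    (hφ : HasFibreIn (closureCompacts G ⊓ M (1 - A - N)) φ) :
    ∃ (C' : T) (ψ : C ⟶ C'), HasFibreIn (closureCompacts G ⊓ M (1 - A - N)) (φ ≫ ψ) ∧
      IsGhost (small G (Set.Ici m)) ψ := by
  obtain ⟨l, hl⟩ : ∃ l : ℕ, (A : ℤ) - (1 - A - N - 1 + l + 1) ≤ m :=
    ⟨(2 * A + N - m).toNat, by lia⟩
  let m' : ℤ := min m (-A - (1 - A - N - 1) - l)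
  obtain ⟨C', ψ, hψ, hφψ⟩ := h.exists_ghostPow hN hfin hF m' (A * (l + 1)) hφ
  refine ⟨C', ψ, hφψ, fun K hK f => ?_⟩
  obtain ⟨n, hn⟩ := exists_killed_of_small hK
  obtain ⟨C'', ψ', hψ', hφψ'⟩ := h.exists_ghostPow hN hfin hF m' n hφψ
  obtain ⟨Z, z, e, hZ, hZ'⟩ := h.hasFibreIn_of_comp hφ (ψ := ψ ≫ ψ') (by rwa [← Category.assoc])
  obtain ⟨g, rfl⟩ : ∃ g : K ⟶ Z, f = g ≫ z := Triangle.coyoneda_exact₂ _ hZ f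
    (show f ≫ ψ ≫ ψ' = 0 by
      rw [← Category.assoc]
      exact hn ψ' (hψ'.anti (slice_mono G (Set.Ici_subset_Ici.2 (min_le_left _ _)))) _)
  rw [Category.assoc]
  exact h.comp_ghostPow_eq_zero hfin hl (min_le_right _ _) hK hZ' g z hψ

omit hF hN in
lemma isGhost_closureCompacts {C B : T} {p : ℤ} (hB : (metricM G p).rightOrthogonal B)
    {w : C ⟶ B} (hw : IsGhost (small G (Set.Ici (-2 * A - p))) w) :
    IsGhost (closureCompacts G) w := by
  intro K hK y
  obtain ⟨E, D, a, b, c, hT, hE, hD, hD'⟩ := h.exists_approx_Ici hfin hK (p + A)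
  obtain ⟨g, hg⟩ : ∃ g : D ⟶ B, y ≫ w = b ≫ g := Triangle.yoneda_exact₂ _ hT (y ≫ w)
    (show a ≫ y ≫ w = 0 by
      rw [← Category.assoc, hw E (small_mono G (Set.Ici_subset_Ici.2 (by lia)) E hE)])
  rw [hg, metricR_anti G (by lia) _ (h.metricR_of_metric hfin hD hD') g hB, comp_zero]

/-- The cone `C₂` of an approximation of `F` is reached by two maps with the property that, up to
the metric, each of them is a phantom map; so `F ⟶ C₂` vanishes up to the metric. -/
lemma retractClosure_extensionProduct_metricR [HasCoproducts.{v} T]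
    (hph : Killed (compacts T) 2 F) (q : ℤ) :
    ((closureCompacts G).extensionProduct (metricR G q)).retractClosure F := by
  have := h.isTriangulated_closureCompacts
  have := h.isExtRetractClosed (1 - A - N)
  obtain ⟨p, hp⟩ : ∃ p : ℤ, p = q + 4 * A + 1 := ⟨_, rfl⟩
  obtain ⟨C₁, ψ₁, hψ₁, hg₁⟩ := h.exists_annihilates_small hN hfin hF (-2 * A - p) (.id F)
  obtain ⟨C₂, ψ₂, hψ₂, hg₂⟩ := h.exists_annihilates_small hN hfin hF (-2 * A - p) hψ₁
  rw [Category.id_comp] at hψ₁ hψ₂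
  obtain ⟨X₁, B₁, a₁, b₁, c₁, hT₁, hX₁, hB₁⟩ := h.generating.exists_metric_torsion_triangle p C₁
  obtain ⟨X₂, B₂, a₂, b₂, c₂, hT₂, hX₂, hB₂⟩ := h.generating.exists_metric_torsion_triangle q C₂
  obtain ⟨x, hx⟩ : ∃ x : B₁ ⟶ B₂, ψ₂ ≫ b₂ = b₁ ≫ x :=
    Triangle.yoneda_exact₂ _ hT₁ _ (metricR_anti G (by lia) _ hX₁ _ hB₂)
  have phantom₁ : IsGhost (closureCompacts G) (ψ₁ ≫ b₁) :=
    h.isGhost_closureCompacts hfin hB₁ fun E hE a => by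
      rw [← Category.assoc, hg₁ E hE, zero_comp]
  have hX₁' : M (p - 1 - A) (X₁⟦(1 : ℤ)⟧) := h.metricR_le (n := p - 1) (by lia) _
    (h.isGeneratingSequence.metricR_shift (by simp) hX₁)
  have phantom₂ : IsGhost (closureCompacts G) x :=
    h.isGhost_closureCompacts hfin hB₂ fun E hE a => by
      obtain ⟨e, rfl⟩ : ∃ e : E ⟶ C₁, a = e ≫ b₁ := Triangle.coyoneda_exact₃ _ hT₁ _
        (h.le_rightOrthogonal_small (m := -2 * A - q) (by lia) _ hX₁' _ hE)
      have hE' : small G (Set.Ici (-2 * A - p)) E :=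
        small_mono G (Set.Ici_subset_Ici.2 (by lia)) E hE
      rw [Category.assoc, ← hx, reassoc_of% hg₂ E hE' e, zero_comp]
  have comp_eq_zero : (ψ₁ ≫ ψ₂) ≫ b₂ = 0 := by
    have := hph _ (GhostPow.anti (compacts_le_closureCompacts G)
      ⟨_, ψ₁ ≫ b₁, x, phantom₁, ⟨_, x, 𝟙 B₂, phantom₂, trivial, by simp⟩, rfl⟩) (𝟙 F)
    simpa [hx] using this
  obtain ⟨P, p₀, d, hT, hP, -⟩ := hψ₂
  obtain ⟨Y, y, e, r, s, hY, hPY, -⟩ := exists_fibre_comp hT hT₂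
  obtain ⟨t, ht⟩ : ∃ t : F ⟶ Y, 𝟙 F = t ≫ y := Triangle.coyoneda_exact₂ _ hY (𝟙 F)
    ((Category.id_comp _).trans comp_eq_zero)
  exact ⟨Y, ⟨P, X₂, r, s, _, hPY, hP, hX₂⟩, ⟨⟨t, y, ht.symm⟩⟩⟩

end IsQuasiapproximableWith

end Tower

section Biproducts

variable {T : Type u} [Category.{v} T] [HasZeroObject T] [HasShift T ℤ] [Preadditive T]
  [∀ n : ℤ, (shiftFunctor T n).Additive] [Pretriangulated T]

lemma exists_iso_biprod_of_retract {F Y : T} (r : Retract F Y) :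
    ∃ F' : T, Nonempty (Y ≅ F ⊞ F') := by
  obtain ⟨F', q, d, h⟩ := distinguished_cocone_triangle r.i
  have : Mono r.i := ⟨fun f g hfg => by simpa using hfg =≫ r.r⟩
  obtain ⟨e, -, -⟩ := exists_iso_binaryBiproduct_of_distTriang _ h
    (Triangle.mor₃_eq_zero_of_mono₁ _ h this)
  exact ⟨F', ⟨e⟩⟩

lemma exists_cone_snd_comp_inl [IsTriangulated T] (V U V' : T) :
    ∃ (Z : T) (b : U ⊞ V' ⟶ Z) (c : Z ⟶ (V ⊞ U)⟦(1 : ℤ)⟧),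
      Triangle.mk ((biprod.snd : V ⊞ U ⟶ U) ≫ (biprod.inl : U ⟶ U ⊞ V')) b c ∈ distTriang T ∧
        Nonempty (Z ≅ V⟦(1 : ℤ)⟧ ⊞ V') := by
  obtain ⟨Z, b, c, p, q, h, h'⟩ := exists_cone_comp
    (rot_of_distTriang _ (binaryBiproductTriangle_distinguished V U))
    (binaryBiproductTriangle_distinguished U V')
  obtain ⟨e, -, -⟩ := exists_iso_binaryBiproduct_of_distTriang _ h' zero_comp
  exact ⟨Z, b, c, h, ⟨e⟩⟩

variable (P : ObjectProperty T)

/-- Since `F⟦n⟧ ⊞ F` and `F ⊞ F⟦-1⟧` have the property `P`, so does the cone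
`F⟦n + 1⟧ ⊞ F⟦-1⟧` of a map between them; this changes `n` by two. -/
lemma prop_biprod_shift_of_odd [IsTriangulated T] [P.IsTriangulated]
    [P.IsClosedUnderIsomorphisms] {F : T} (h : P (F⟦(1 : ℤ)⟧ ⊞ F)) {n : ℤ} (hn : Odd n) :
    P (F⟦n⟧ ⊞ F) := by
  have shift {X Y X' Y' : T} (a : ℤ) (e : X⟦a⟧ ≅ X') (e' : Y⟦a⟧ ≅ Y') (hXY : P (X ⊞ Y)) :
      P (X' ⊞ Y') :=
    have := preservesBinaryBiproducts_of_preservesBiproducts (shiftFunctor T a)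
    P.prop_of_iso ((shiftFunctor T a).mapBiprod X Y ≪≫ biprod.mapIso e e') (P.le_shift a _ hXY)
  have neg {n : ℤ} (hn : P (F⟦n⟧ ⊞ F)) : P (F⟦-n⟧ ⊞ F) :=
    P.prop_of_iso (biprod.braiding _ _)
      (shift (-n) ((shiftFunctorCompIsoId T n (-n) (by lia)).app F) (Iso.refl _) hn)
  have add_two {n : ℤ} (hn : P (F⟦n⟧ ⊞ F)) : P (F⟦n + 1 + 1⟧ ⊞ F) := by
    have h' : P (F ⊞ F⟦(-1 : ℤ)⟧) := P.prop_of_iso (biprod.braiding _ _) (neg h)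
    obtain ⟨Z, b, c, hT, ⟨e⟩⟩ := exists_cone_snd_comp_inl (F⟦n⟧) F (F⟦(-1 : ℤ)⟧)
    exact shift 1 ((shiftFunctor T 1).mapIso ((shiftFunctorAdd T n 1).symm.app F) ≪≫
      (shiftFunctorAdd T (n + 1) 1).symm.app F) ((shiftFunctorCompIsoId T (-1) 1 (by lia)).app F)
      (P.prop_of_iso e (P.ext_of_isTriangulatedClosed₃ _ hT hn h'))
  have nat (k : ℕ) : P (F⟦(2 * k + 1 : ℤ)⟧ ⊞ F) := by
    induction k with
    | zero => simpa using h
    | succ k ih =>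
      rw [show 2 * ((k + 1 : ℕ) : ℤ) + 1 = 2 * k + 1 + 1 + 1 by push_cast; ring]
      exact add_two ih
  obtain ⟨k, rfl⟩ := hn
  rcases le_or_gt 0 k with hk | hk
  · obtain ⟨m, rfl⟩ := Int.eq_ofNat_of_zero_le hk
    exact nat m
  · rw [show 2 * k + 1 = -(2 * ((-k - 1).toNat : ℤ) + 1) by lia]
    exact neg (nat _)

end Biproducts

section Thick

variable {T : Type u} [Category.{v} T] [HasZeroObject T] [HasShift T ℤ] [Preadditive T]
  [∀ n : ℤ, (shiftFunctor T n).Additive] [Pretriangulated T] {G M : ℤ → ObjectProperty T} {A : ℕ}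

lemma IsPreapproximableWith.exists_shift_metricM (h : IsPreapproximableWith G M A) {i : ℤ} {X : T}
    (hX : metricM G i X) (k : ℕ) : ∃ n : ℤ, |n| ≤ k * A ∧ metricM G (i + k) (X⟦n⟧) := by
  have closed (j : ℤ) : IsExtRetractClosed (metricM G j) :=
    inferInstanceAs (IsExtRetractClosed (small G _))
  induction k with
  | zero =>
    exact ⟨0, by simp, (metricM G _).prop_of_iso ((shiftFunctorZero T ℤ).symm.app X) (by simpa)⟩
  | succ k ih =>
    obtain ⟨n, hn, hX'⟩ := ih
    obtain ⟨m, hm, Y, hY, ⟨e⟩⟩ := h.shift _ _ hX'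
    refine ⟨n + -m, ?_, ?_⟩
    · calc
        |n + -m| ≤ |n| + |m| := by simpa using abs_add_le n (-m)
        _ ≤ k * A + A := add_le_add hn hm
        _ = _ := by push_cast; ring
    · rw [Nat.cast_succ, ← add_assoc]
      exact (metricM G _).prop_of_iso ((shiftFunctorAdd T n (-m)).app X ≪≫
        (shiftFunctor T (-m)).mapIso e ≪≫
          (shiftFunctorCompIsoId T m (-m) (by lia)).app Y).symm hY

namespace IsQuasiapproximableWith

variable [IsTriangulated T] (h : IsQuasiapproximableWith G M A)
  {R : Type w} [CommRing R] [IsNoetherianRing R] [Linear R T]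
  (hfin : compacts T ≤ HomFiniteFrom R (compacts T))

include h hfin

lemma exists_shift_metricR {X : T} (hX : closureCompacts G X) (m : ℤ) :
    ∃ n : ℤ, metricR G m (X⟦n⟧) := by
  obtain ⟨a, ha⟩ := h.exists_metric hX
  obtain ⟨k, hk⟩ : ∃ k : ℕ, m ≤ a - A + k := ⟨(m - (a - A)).toNat, by lia⟩
  obtain ⟨l, hl⟩ : ∃ l : ℕ, m + k * A ≤ a + l + 1 - A := ⟨(m + k * A - (a + 1 - A)).toNat, by lia⟩
  obtain ⟨E, D, x, y, z, hT, hE, -, hD, hD'⟩ := h.exists_iterated_approx hfin ha hX l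
  have hE' : metricM G (a - A) E :=
    small_mono G (Set.Icc_subset_Iic_self.trans (Set.Iic_subset_Iic.2 (by lia))) E hE
  obtain ⟨n, hn, hEn⟩ := h.preapproximable.exists_shift_metricM hE' k
  exact ⟨n, (metricR G m).ext_of_isTriangulatedClosed₂ _ (Triangle.shift_distinguished _ hT n)
    (metricR_anti G hk _ (metricM_le_metricR G _ _ hEn))
    (h.isGeneratingSequence.metricR_shift (by lia) (h.metricR_of_metric hfin hD hD'))⟩

lemma exists_odd_shift_metricR {X : T} (hX : closureCompacts G X) (m : ℤ) :
    ∃ n : ℤ, Odd n ∧ metricR G m (X⟦n⟧) := by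
  obtain ⟨n, hn⟩ := h.exists_shift_metricR hfin hX (m + 1)
  rcases Int.even_or_odd n with even | odd
  · exact ⟨n + 1, even.add_one, (metricR G m).prop_of_iso ((shiftFunctorAdd T n 1).symm.app X)
      (h.isGeneratingSequence.metricR_shift (by simp) hn)⟩
  · exact ⟨n, odd, metricR_anti G (by lia) _ hn⟩

/-- As `F⟦n⟧ ⊞ F` is in the closure for all odd `n`, the object `F` agrees with objects of the
closure up to the shifts `F⟦n⟧`, which are arbitrarily small for suitable odd `n`. -/
lemma closureCompacts_of_biprod_shift {F : T} (hF : closureCompacts G (F⟦(1 : ℤ)⟧ ⊞ F)) :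
    closureCompacts G F := by
  have := h.isTriangulated_closureCompacts
  intro m
  obtain ⟨n, odd, hn⟩ := h.exists_odd_shift_metricR hfin hF (m + 1)
  have hFn : metricR G (m + 1) (F⟦n⟧) := (metricR G (m + 1)).prop_of_retract
    ((⟨biprod.inr, biprod.snd, by simp⟩ : Retract F (F⟦(1 : ℤ)⟧ ⊞ F)).map (shiftFunctor T n)) hn
  obtain ⟨E, D, a, b, c, hT, hE, hD⟩ := prop_biprod_shift_of_odd (closureCompacts G) hF odd m
  obtain ⟨Z, x, y, p, q, hZ, hZ'⟩ := exists_cone_comp hT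
    (rot_of_distTriang _ (binaryBiproductTriangle_distinguished (F⟦n⟧) F))
  exact ⟨E, Z, _, _, _, hZ, hE, (metricR G m).ext_of_isTriangulatedClosed₂ _ hZ' hD
    (h.isGeneratingSequence.metricR_shift (by simp) hFn)⟩

lemma extensionProduct_closureCompacts_le {m l : ℤ} (hl : m ≤ l + 1 - A) :
    (closureCompacts G).extensionProduct (metricR G m) ≤
      (small G (Set.Ici (-A - l))).extensionProduct (metricR G m) := by
  rintro Y ⟨P, X, a, b, c, hT, hP, hX⟩
  obtain ⟨E, D, i, p, q, hE, hE', hD, hD'⟩ := h.exists_approx_Ici hfin hP l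
  obtain ⟨Z, x, y, _, _, hZ, hZ'⟩ := exists_cone_comp hE hT
  exact ⟨E, Z, _, x, y, hZ, hE', (metricR G m).ext_of_isTriangulatedClosed₂ _ hZ'
    (metricR_anti G hl _ (h.metricR_of_metric hfin hD hD')) hX⟩

/-- A complement `F'` of `F` in an object near the closure gives a map `F ⊞ F' ⟶ F' ⊞ F` with cone
`F⟦1⟧ ⊞ F`, and this map can be approximated by a map of compact objects. -/
lemma closureCompacts_of_bounded [HasCoproducts.{v} T] {F : T} {N : ℤ}
    (hN : (small G (Set.Ici N)).rightOrthogonal F) (hF : HomFiniteFrom R (compacts T) F)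
    (hph : Killed (compacts T) 2 F) : closureCompacts G F := by
  refine h.closureCompacts_of_biprod_shift hfin fun n => ?_
  obtain ⟨Y, hY, ⟨r⟩⟩ :=
    h.retractClosure_extensionProduct_metricR hN hfin hF hph (n + 4 * A + 1)
  obtain ⟨F', ⟨e⟩⟩ := exists_iso_biprod_of_retract r
  have small_le (m : ℤ) : small G (Set.Ici m) ≤ compacts T :=
    h.isGeneratingSequence.small_le_compacts _
  have hY₁ := ObjectProperty.monotone_extensionProduct_right _
    (metricR_anti G (show n + 1 ≤ n + 4 * A + 1 by lia)) _ hY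
  obtain ⟨E₁, D₁, i₁, p₁, q₁, h₁, hE₁, hD₁⟩ := ObjectProperty.prop_of_iso _ e
    (h.extensionProduct_closureCompacts_le hfin (l := n + A) (by lia) _ hY₁)
  obtain ⟨E₂, D₂, i₂, p₂, q₂, h₂, hE₂, hD₂⟩ := ObjectProperty.prop_of_iso _
    (e ≪≫ biprod.braiding _ _)
    (h.extensionProduct_closureCompacts_le hfin (l := n + 5 * A) (by lia) _ hY)
  obtain ⟨Z, u, v, hZ, ⟨eZ⟩⟩ := exists_cone_snd_comp_inl F F' F
  obtain ⟨g, hg⟩ : ∃ g : E₁ ⟶ E₂, i₁ ≫ biprod.snd ≫ biprod.inl = g ≫ i₂ :=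
    Triangle.coyoneda_exact₂ _ h₂ _ (h.le_rightOrthogonal_small (i := n + 3 * A + 1) (by lia) _
      (h.metricR_le (by lia) _ hD₂) _ hE₁)
  obtain ⟨E₃, g', g'', hE⟩ := distinguished_cocone_triangle g
  obtain ⟨D₃, i₃, p₃, q₃, _, _, _, h₃, h₄⟩ := exists_cone_map hE hZ h₁ h₂ hg.symm
  refine ObjectProperty.prop_of_iso _ eZ ⟨E₃, D₃, i₃, p₃, q₃, h₃, ?_, ?_⟩
  · exact h.isGeneratingSequence.compacts_cone hE (small_le _ _ hE₁) (small_le _ _ hE₂)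
  · exact (metricR G n).ext_of_isTriangulatedClosed₂ _ h₄ (metricR_anti G (by lia) _ hD₂)
      (h.isGeneratingSequence.metricR_shift (by simp) hD₁)

end IsQuasiapproximableWith

end Thick

section Covers

variable {C : Type*} [Category* C] [Preadditive C] [HasFiniteBiproducts C] {R : Type*} [CommRing R]
  [Linear R C] (H : Cᵒᵖ ⥤ ModuleCat R) [IsLinearPresheaf R H]
  {U : ObjectProperty C} (hU : Set.Finite {X | U X})

include hU

lemma exists_cover_values (hH : ∀ X, Module.Finite R (H.obj (op X))) :
    ∃ (S : C) (z : H.obj (op S)), ∀ X, U X → ∀ y, ∃ f : X ⟶ S, res H f z = y := by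
  have : (⊤ : ObjectProperty C).IsClosedUnderFiniteProducts := ⟨fun _ => inferInstance⟩
  obtain ⟨S, z, -, -, hz⟩ :=
    exists_cover H (fun _ => ⊤) (by simp) (Q := ⊤) le_top hU fun X _ => (hH X).fg_top
  exact ⟨S, z, fun X hX y => hz X hX (Submodule.mem_top (x := y))⟩

lemma exists_cover_relations [IsNoetherianRing R] {S : C}
    (hS : ∀ X, U X → Module.Finite R (X ⟶ S)) (z : H.obj (op S)) :
    ∃ (L : C) (l : L ⟶ S), res H l z = 0 ∧
      ∀ X, U X → ∀ f : X ⟶ S, res H f z = 0 → ∃ s : X ⟶ L, s ≫ l = f := by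
  have : (⊤ : ObjectProperty C).IsClosedUnderFiniteProducts := ⟨fun _ => inferInstance⟩
  obtain ⟨L, l, -, hl, hL⟩ := exists_cover ((linearYoneda R C).obj S)
    (fun X => LinearMap.ker (evalHom H X z))
    (fun X Y f g hg => (res_comp H f g z).trans ((congrArg _ hg).trans (map_zero _)))
    (Q := ⊤) le_top hU fun X hX => by
      have := hS X hX
      have : IsNoetherian R (X ⟶ S) := inferInstance
      exact this.noetherian _
  exact ⟨L, l, hl, fun X hX f hf => hL X hX hf⟩

end Covers

section Cohomological

variable {T : Type u} [Category.{v} T] [HasZeroObject T] [HasShift T ℤ] [Preadditive T]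
  [∀ n : ℤ, (shiftFunctor T n).Additive] [Pretriangulated T] {R : Type w} [CommRing R] [Linear R T]

instance (F : T) : IsLinearPresheaf R ((restrictedYoneda T R).obj F) where
  toAdditive := inferInstanceAs (((compacts T).ι.op ⋙ (linearYoneda R T).obj F).Additive)
  map_smul f r := IsLinearPresheaf.map_smul (H := (linearYoneda R T).obj F) f.hom r

variable (R) in
lemma restrictedYoneda_isCohomological (F : T) :
    IsCohomological ((restrictedYoneda T R).obj F) where
  additive := inferInstance
  map_smul := IsLinearPresheaf.map_smul
  exact X Y Z a b c h y := by
    refine ⟨fun hy => (Triangle.yoneda_exact₂ _ h y hy).imp fun _ => Eq.symm, ?_⟩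
    rintro ⟨z, rfl⟩
    have a_comp_b : a.hom ≫ b.hom = 0 := comp_distTriang_mor_zero₁₂ _ h
    exact (reassoc_of% a_comp_b) z |>.trans zero_comp

variable {G : ℤ → ObjectProperty T} {H : (compacts T).FullSubcategoryᵒᵖ ⥤ ModuleCat.{v} R}

namespace IsCohomological

lemma isLinearPresheaf (hH : IsCohomological H) : IsLinearPresheaf R H where
  toAdditive := hH.additive
  map_smul := hH.map_smul

/-- `K'` is the cone of a cover of the relations of `z`, where `z` covers `x` and the values of `H`
on `U`. -/
lemma exists_cover_killing_relations [IsNoetherianRing R] (hH : IsCohomological H)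
    (hG : IsGeneratingSequence G)
    (hfin : compacts T ≤ HomFiniteFrom R (compacts T))
    (hHf : ∀ K : (compacts T).FullSubcategory, Module.Finite R (H.obj (op K)))
    {U : ObjectProperty (compacts T).FullSubcategory} (hU : Set.Finite {X | U X})
    {K : (compacts T).FullSubcategory} (x : H.obj (op K)) :
    ∃ (K' : (compacts T).FullSubcategory) (x' : H.obj (op K')) (t : K ⟶ K'), res H t x' = x ∧
      (∀ X, U X → ∀ y, ∃ f : X ⟶ K', res H f x' = y) ∧
      ∀ X, U X → ∀ f : X ⟶ K, res H f x = 0 → f ≫ t = 0 := by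
  have := hH.isLinearPresheaf
  have := hG.isExtRetractClosed_compacts
  have := isClosedUnderFiniteProducts_of_ext (compacts T)
  have := HasFiniteBiproducts.of_hasFiniteProducts (C := (compacts T).FullSubcategory)
  obtain ⟨S, z, hz⟩ :=
    exists_cover_values H (U := fun X => U X ∨ X = K) (hU.union (Set.finite_singleton K)) hHf
  obtain ⟨i, hi⟩ := hz K (.inr rfl) x
  obtain ⟨L, l, hl, hL⟩ := exists_cover_relations H hU (fun X _ =>
    have := hfin _ S.2 _ X.2
    Module.Finite.equiv (InducedCategory.homLinearEquiv (R := R) (X := X) (Y := S)).symm) z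
  obtain ⟨K', p, q, h⟩ := distinguished_cocone_triangle l.hom
  let p' : S ⟶ ⟨K', hG.compacts_cone h L.2 S.2⟩ := ObjectProperty.homMk p
  have l_comp_p : l ≫ p' = 0 := by
    ext
    exact comp_distTriang_mor_zero₁₂ _ h
  obtain ⟨x', hx'⟩ : ∃ x', res H p' x' = z := (hH.exact _ _ _ l p' q h z).1 hl
  refine ⟨_, x', i ≫ p', by rw [res_comp, hx', hi], fun X hX y => ?_, fun X hX f hf => ?_⟩
  · obtain ⟨s, hs⟩ := hz X (.inl hX) y
    exact ⟨s ≫ p', by rw [res_comp, hx', hs]⟩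
  · obtain ⟨s, hs⟩ := hL X hX (f ≫ i) (by rw [res_comp, hi, hf])
    rw [← Category.assoc, ← hs, Category.assoc, l_comp_p, comp_zero]

lemma exists_covering_sequence [IsNoetherianRing R] (hH : IsCohomological H)
    (hG : IsGeneratingSequence G)
    (hfin : compacts T ≤ HomFiniteFrom R (compacts T))
    (hHf : ∀ K : (compacts T).FullSubcategory, Module.Finite R (H.obj (op K)))
    {U : ℕ → ObjectProperty (compacts T).FullSubcategory} (hU : ∀ n, Set.Finite {X | U n X}) :
    ∃ (S : ℕ ⥤ (compacts T).FullSubcategory) (x : ∀ n, H.obj (op (S.obj n))),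
      (∀ ⦃m n : ℕ⦄ (hmn : m ≤ n), res H (S.map (homOfLE hmn)) (x n) = x m) ∧
      (∀ n X, U n X → ∀ y, ∃ f : X ⟶ S.obj (n + 1), res H f (x (n + 1)) = y) ∧
      ∀ n X, U n X → ∀ f : X ⟶ S.obj n, res H f (x n) = 0 →
        f ≫ S.map (homOfLE n.le_succ) = 0 := by
  have := hG.isExtRetractClosed_compacts
  let E := (H ⋙ forget _).Elements
  obtain ⟨S, -, hS⟩ := exists_sequence (C := Eᵒᵖ)
    (P := fun n p q t =>
      (∀ X, U n X → ∀ y, ∃ f : X ⟶ q.unop.1.unop, res H f q.unop.2 = y) ∧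
      ∀ X, U n X → ∀ f : X ⟶ p.unop.1.unop, res H f p.unop.2 = 0 → f ≫ t.unop.1.unop = 0)
    (fun n p => by
      obtain ⟨K', x', t, ht, h⟩ := hH.exists_cover_killing_relations hG hfin hHf (hU n) p.unop.2
      exact ⟨op ⟨op K', x'⟩, Quiver.Hom.op ⟨t.op, ht⟩, h⟩)
    (op ⟨op ⟨_, (compacts T).prop_of_isZero (isZero_zero T)⟩, 0⟩)
  exact ⟨S ⋙ (CategoryOfElements.π _).leftOp, fun n => (S.obj n).unop.2,
    fun m n hmn => (S.map (homOfLE hmn)).unop.2, fun n => (hS n).1, fun n => (hS n).2⟩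

end IsCohomological

end Cohomological

section Comparison

variable {T : Type u} [Category.{v} T] [HasZeroObject T] [HasShift T ℤ] [Preadditive T]
  [∀ n : ℤ, (shiftFunctor T n).Additive] [Pretriangulated T] [HasColimitsOfShape (Discrete ℕ) T]

lemma exists_comp_map_eq_of_hocolim {S : ℕ ⥤ T} {F : T} {π : (∐ S.obj) ⟶ F}
    {δ : F ⟶ (∐ S.obj)⟦(1 : ℤ)⟧} (h : Triangle.mk (telescope S) π δ ∈ distTriang T) {K : T}
    (hK : compacts T K) {m n : ℕ} (f : K ⟶ S.obj m) (g : K ⟶ S.obj n)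
    (hfg : f ≫ Sigma.ι S.obj m ≫ π = g ≫ Sigma.ι S.obj n ≫ π) :
    ∃ (l : ℕ) (hm : m ≤ l) (hn : n ≤ l),
      f ≫ S.map (homOfLE hm) = g ≫ S.map (homOfLE hn) := by
  obtain ⟨k, hm, hn⟩ := exists_ge_ge m n
  obtain ⟨l, hl, hfg⟩ := exists_comp_map_eq_zero_of_hocolim h hK
    (f ≫ S.map (homOfLE hm) - g ≫ S.map (homOfLE hn)) (by
      simp only [Preadditive.sub_comp, Category.assoc, map_ι_hocolim h, hfg, sub_self])
  refine ⟨l, hm.trans hl, hn.trans hl, ?_⟩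
  simpa only [Preadditive.sub_comp, Category.assoc, ← S.map_comp, homOfLE_comp, sub_eq_zero]
    using hfg

variable {S : ℕ ⥤ (compacts T).FullSubcategory} {F : T} {π : (∐ (S ⋙ (compacts T).ι).obj) ⟶ F}
  {δ : F ⟶ (∐ (S ⋙ (compacts T).ι).obj)⟦(1 : ℤ)⟧}
  (h : Triangle.mk (telescope (S ⋙ (compacts T).ι)) π δ ∈ distTriang T)

include h

lemma eventually_factors_hocolim {K : (compacts T).FullSubcategory} (f : K.obj ⟶ F) :
    ∀ᶠ n in Filter.atTop,
      ∃ g : K ⟶ S.obj n, f = g.hom ≫ Sigma.ι (S ⋙ (compacts T).ι).obj n ≫ π := by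
  obtain ⟨m, g, rfl⟩ := exists_factors_hocolim h K.2 f
  filter_upwards [Filter.eventually_ge_atTop m] with n hmn
  refine ⟨ObjectProperty.homMk g ≫ S.map (homOfLE hmn), ?_⟩
  exact (congrArg _ (map_ι_hocolim h hmn).symm).trans (Category.assoc _ _ _).symm

variable {R : Type w} [CommRing R] {H : (compacts T).FullSubcategoryᵒᵖ ⥤ ModuleCat.{v} R}
  {x : ∀ n, H.obj (op (S.obj n))}
  (hx : ∀ ⦃m n : ℕ⦄ (hmn : m ≤ n), res H (S.map (homOfLE hmn)) (x n) = x m)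

include hx

lemma res_eq_res_of_hocolim {K : (compacts T).FullSubcategory} {m n : ℕ} (f : K ⟶ S.obj m)
    (g : K ⟶ S.obj n) (hfg : f.hom ≫ Sigma.ι (S ⋙ (compacts T).ι).obj m ≫ π =
      g.hom ≫ Sigma.ι (S ⋙ (compacts T).ι).obj n ≫ π) :
    res H f (x m) = res H g (x n) := by
  obtain ⟨l, hm, hn, hl⟩ := exists_comp_map_eq_of_hocolim h K.2 f.hom g.hom hfg
  have : f ≫ S.map (homOfLE hm) = g ≫ S.map (homOfLE hn) := by
    ext
    exact hl
  rw [← hx hm, ← hx hn, ← res_comp, ← res_comp, this]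

lemma exists_comparison [Linear R T] [IsLinearPresheaf R H] :
    ∃ φ : (restrictedYoneda T R).obj F ⟶ H,
      ∀ (K : (compacts T).FullSubcategory) (n : ℕ) (f : K ⟶ S.obj n),
        φ.app (op K) (f.hom ≫ Sigma.ι (S ⋙ (compacts T).ι).obj n ≫ π) = res H f (x n) := by
  let j (n : ℕ) : (S.obj n).obj ⟶ F := Sigma.ι (S ⋙ (compacts T).ι).obj n ≫ π
  choose N g hg using fun (K : (compacts T).FullSubcategory) (f : K.obj ⟶ F) =>
    (eventually_factors_hocolim h f).exists
  have value_eq {K : (compacts T).FullSubcategory} (f : K.obj ⟶ F) {n : ℕ} (g' : K ⟶ S.obj n)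
      (hg' : f = g'.hom ≫ j n) : res H (g K f) (x (N K f)) = res H g' (x n) :=
    res_eq_res_of_hocolim h hx _ _ ((hg K f).symm.trans hg')
  refine ⟨{
    app K := ModuleCat.ofHom (Y := H.obj K)
      { toFun := fun f : K.unop.obj ⟶ F => res H (g K.unop f) (x (N K.unop f))
        map_add' := fun f f' => ?_
        map_smul' := fun r f => ?_ }
    naturality K L s := ?_ }, fun K n f => value_eq _ f rfl⟩
  · obtain ⟨n, ⟨a, ha⟩, b, hb⟩ :=
      ((eventually_factors_hocolim h f).and (eventually_factors_hocolim h f')).exists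
    rw [value_eq f a ha, value_eq f' b hb]
    refine (value_eq _ (a + b) ?_).trans ((evalHom H K.unop (x n)).map_add a b)
    exact (congrArg₂ _ ha hb).trans (Preadditive.add_comp _ _ _ _ _ _).symm
  · refine (value_eq _ (r • g K.unop f) ?_).trans ((evalHom H K.unop (x _)).map_smul _ _)
    exact (congrArg _ (hg K.unop f)).trans (Linear.smul_comp _ _ _ _ _ _).symm
  · ext f
    refine (value_eq _ (s.unop ≫ g K.unop f) ?_).trans (res_comp H _ _ _)
    exact (congrArg _ (hg K.unop f)).trans (Category.assoc _ _ _).symm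

omit hx in
lemma isIso_comparison_app [Linear R T] {φ : (restrictedYoneda T R).obj F ⟶ H}
    (hφ : ∀ (K : (compacts T).FullSubcategory) (n : ℕ) (f : K ⟶ S.obj n),
      φ.app (op K) (f.hom ≫ Sigma.ι (S ⋙ (compacts T).ι).obj n ≫ π) = res H f (x n))
    {K : (compacts T).FullSubcategory} {l : ℕ}
    (hsurj : ∀ y, ∃ (n : ℕ) (f : K ⟶ S.obj n), res H f (x n) = y)
    (hinj : ∀ n ≥ l, ∀ f : K ⟶ S.obj n, res H f (x n) = 0 →
      f ≫ S.map (homOfLE n.le_succ) = 0) :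
    IsIso (φ.app (op K)) := by
  refine (ConcreteCategory.isIso_iff_bijective _).2
    ⟨(injective_iff_map_eq_zero (φ.app (op K)).hom).2 fun f hf => ?_, fun y => ?_⟩
  · obtain ⟨n, ⟨g, rfl⟩, hn⟩ :=
      ((eventually_factors_hocolim h f).and (Filter.eventually_ge_atTop l)).exists
    have g_comp_map : g.hom ≫ (S.map (homOfLE n.le_succ)).hom = 0 :=
      congrArg InducedCategory.Hom.hom (hinj n hn g ((hφ K n g).symm.trans hf))
    rw [← map_ι_hocolim h n.le_succ]
    exact (reassoc_of% g_comp_map) _ |>.trans zero_comp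
  · obtain ⟨n, f, rfl⟩ := hsurj y
    exact ⟨_, hφ K n f⟩

end Comparison

section FiveLemma

variable {T : Type u} [Category.{v} T] [HasZeroObject T] [HasShift T ℤ] [Preadditive T]
  [∀ n : ℤ, (shiftFunctor T n).Additive] [Pretriangulated T] {R : Type w} [CommRing R]
  {H H' : (compacts T).FullSubcategoryᵒᵖ ⥤ ModuleCat.{v} R}

/-- The compact objects at which a transformation of functors on `Tᶜ` is invertible. -/
def IsIsoAt (φ : H ⟶ H') : ObjectProperty T :=
  fun X => ∃ hX : compacts T X, IsIso (φ.app (op ⟨X, hX⟩))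

instance (φ : H ⟶ H') [(compacts T).IsStableUnderRetracts] :
    (IsIsoAt φ).IsStableUnderRetracts where
  of_retract {X Y} r hY := by
    obtain ⟨hY, hφ⟩ := hY
    have hX := (compacts T).prop_of_retract r hY
    let r' : Retract (⟨X, hX⟩ : (compacts T).FullSubcategory) ⟨Y, hY⟩ :=
      { i := ObjectProperty.homMk r.i
        r := ObjectProperty.homMk r.r
        retract := by
          ext
          exact r.retract }
    exact ⟨hX, MorphismProperty.of_retract (P := .isomorphisms _)
      (NatTrans.retractArrowApp φ r'.op) hφ⟩

variable [Linear R T] {φ : H ⟶ H'} {G : ℤ → ObjectProperty T}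

lemma IsIsoAt.ext (hH : IsCohomological H) (hH' : IsCohomological H')
    [(compacts T).IsTriangulatedClosed₂] [(compacts T).IsClosedUnderIsomorphisms] {X Y Z : T}
    {a : X ⟶ Y} {b : Y ⟶ Z} {c : Z ⟶ X⟦(1 : ℤ)⟧} (h : Triangle.mk a b c ∈ distTriang T)
    (hX : IsIsoAt φ X) (hZ : IsIsoAt φ Z) (hX₁ : IsIsoAt φ (X⟦(1 : ℤ)⟧))
    (hZ₁ : IsIsoAt φ (Z⟦(-1 : ℤ)⟧)) : IsIsoAt φ Y := by
  obtain ⟨hXc, hX⟩ := hX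
  obtain ⟨hZc, hZ⟩ := hZ
  obtain ⟨hXc₁, hX₁⟩ := hX₁
  obtain ⟨hZc₁, hZ₁⟩ := hZ₁
  have hYc : compacts T Y := (compacts T).ext_of_isTriangulatedClosed₂ _ h hXc hZc
  obtain ⟨d, e, h₁⟩ : ∃ (d : Z⟦(-1 : ℤ)⟧ ⟶ X) (e : Y ⟶ (Z⟦(-1 : ℤ)⟧)⟦(1 : ℤ)⟧),
    Triangle.mk d a e ∈ distTriang T := ⟨_, _, inv_rot_of_distTriang _ h⟩
  let a' : (⟨X, hXc⟩ : (compacts T).FullSubcategory) ⟶ ⟨Y, hYc⟩ := ObjectProperty.homMk a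
  let b' : (⟨Y, hYc⟩ : (compacts T).FullSubcategory) ⟶ ⟨Z, hZc⟩ := ObjectProperty.homMk b
  let c' : (⟨Z, hZc⟩ : (compacts T).FullSubcategory) ⟶ ⟨_, hXc₁⟩ := ObjectProperty.homMk c
  let d' : (⟨_, hZc₁⟩ : (compacts T).FullSubcategory) ⟶ ⟨X, hXc⟩ := ObjectProperty.homMk d
  have comm {K L : (compacts T).FullSubcategory} (f : K ⟶ L) :
      (res H' f).comp (φ.app (op L)).hom = (φ.app (op K)).hom.comp (res H f) :=
    congrArg ModuleCat.Hom.hom (φ.naturality f.op).symm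
  rw [ConcreteCategory.isIso_iff_bijective] at hX hZ hX₁ hZ₁
  refine ⟨hYc, (ConcreteCategory.isIso_iff_bijective _).2 ?_⟩
  exact LinearMap.bijective_of_surjective_of_bijective_of_bijective_of_injective
    (res H c') (res H b') (res H a') (res H d') (res H' c') (res H' b') (res H' a') (res H' d')
    (φ.app _).hom (φ.app _).hom (φ.app _).hom (φ.app _).hom (φ.app _).hom
    (comm c') (comm b') (comm a') (comm d')
    (hH.exact _ _ _ b' c' _ (rot_of_distTriang _ h)) (hH.exact _ _ _ a' b' _ h)
    (hH.exact _ _ _ d' a' _ h₁)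
    (hH'.exact _ _ _ b' c' _ (rot_of_distTriang _ h)) (hH'.exact _ _ _ a' b' _ h)
    (hH'.exact _ _ _ d' a' _ h₁) hX₁.2 hZ hX hZ₁.1

lemma isExtRetractClosed_isIsoAt_shift (hH : IsCohomological H) (hH' : IsCohomological H')
    [IsExtRetractClosed (compacts T)] :
    IsExtRetractClosed fun X => ∀ n : ℤ, IsIsoAt φ (X⟦n⟧) := by
  have : ObjectProperty.IsStableUnderRetracts fun X => ∀ n : ℤ, IsIsoAt φ (X⟦n⟧) :=
    ⟨fun r hY n => (IsIsoAt φ).prop_of_retract (r.map (shiftFunctor T n)) (hY n)⟩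
  exact {
    exists_zero := by
      have := hH.additive
      have := hH'.additive
      obtain ⟨O, hO⟩ := HasZeroObject.zero (C := T)
      refine ⟨O, hO, fun n => ?_⟩
      have hOn : IsZero (O⟦n⟧) := Functor.map_isZero _ hO
      let K : (compacts T).FullSubcategory := ⟨_, (compacts T).prop_of_isZero hOn⟩
      have hK : IsZero K := .of_full_of_faithful_of_isZero (compacts T).ι K hOn
      exact ⟨K.2, 0, (H.map_isZero hK.op).eq_of_src _ _, (H'.map_isZero hK.op).eq_of_src _ _⟩
    toIsTriangulatedClosed₂ := .mk' fun t ht hX hZ n =>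
      .ext hH hH' (Triangle.shift_distinguished _ ht n) (hX n) (hZ n)
        ((IsIsoAt φ).prop_of_iso ((shiftFunctorAdd T n 1).app _) (hX (n + 1)))
        ((IsIsoAt φ).prop_of_iso ((shiftFunctorAdd T n (-1)).app _) (hZ (n + -1))) }

lemma IsGeneratingSequence.isIso_of_isIsoAt_shift (hG : IsGeneratingSequence G)
    (hH : IsCohomological H) (hH' : IsCohomological H')
    (hφ : ∀ X, slice G Set.univ X → ∀ n : ℤ, IsIsoAt φ (X⟦n⟧)) : IsIso φ := by
  have := hG.isExtRetractClosed_compacts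
  have := isExtRetractClosed_isIsoAt_shift (φ := φ) hH hH'
  have isIsoAt_shift : compacts T ≤ fun X => ∀ n : ℤ, IsIsoAt φ (X⟦n⟧) :=
    hG.generates ▸ small_le hφ
  rw [NatTrans.isIso_iff_isIso_app]
  intro K
  exact ((IsIsoAt φ).prop_of_iso ((shiftFunctorZero T ℤ).app K.unop.obj)
    (isIsoAt_shift _ K.unop.2 0)).2

end FiveLemma

section Representability

variable {T : Type u} [Category.{v} T] [HasShift T ℤ]

/-- The shifts by at most `l` of the objects of the `𝒢ʲ` with `|j| ≤ l`. For finite `𝒢` these are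
finitely many, and every shift of every object of `𝒢` is among them for large `l`. -/
def shiftedSlice (G : ℤ → ObjectProperty T) (l : ℕ) : ObjectProperty T :=
  fun X => ∃ a ∈ Set.Icc (-l : ℤ) l, ∃ Y, slice G (Set.Icc (-l : ℤ) l) Y ∧ Y⟦a⟧ = X

lemma exists_forall_shiftedSlice {G : ℤ → ObjectProperty T} {X : T} (hX : slice G Set.univ X)
    (a : ℤ) : ∃ l : ℕ, ∀ n ≥ l, shiftedSlice G n (X⟦a⟧) := by
  obtain ⟨j, -, hX⟩ := hX
  refine ⟨a.natAbs + j.natAbs, fun n hn => ⟨a, ?_, X, ⟨j, ?_, hX⟩, rfl⟩⟩ <;>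
    simp only [Set.mem_Icc] <;> lia

variable [HasZeroObject T] [Preadditive T] [∀ n : ℤ, (shiftFunctor T n).Additive]
  [Pretriangulated T]

lemma IsFiniteGeneratingSequence.finite_shiftedSlice {G : ℤ → ObjectProperty T}
    (hG : IsFiniteGeneratingSequence G) (l : ℕ) : Set.Finite {X | shiftedSlice G l X} := by
  refine ((Set.finite_Icc (-l : ℤ) l).biUnion fun a _ =>
    (hG.finite_slice (Set.finite_Icc (-l : ℤ) l)).image fun Y => Y⟦a⟧).subset ?_
  rintro _ ⟨a, ha, Y, hY, rfl⟩
  exact Set.mem_biUnion ha ⟨Y, hY, rfl⟩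

variable {R : Type w} [CommRing R] [Linear R T] {G : ℤ → ObjectProperty T}
  {H H' : (compacts T).FullSubcategoryᵒᵖ ⥤ ModuleCat.{v} R}

lemma IsCohomological.exists_representing [HasCoproducts.{v} T] [IsNoetherianRing R]
    (hH : IsCohomological H) (hG : IsFiniteGeneratingSequence G)
    (hfin : compacts T ≤ HomFiniteFrom R (compacts T))
    (hHf : ∀ K : (compacts T).FullSubcategory, Module.Finite R (H.obj (op K))) :
    ∃ F : T, Killed (compacts T) 2 F ∧ Nonempty ((restrictedYoneda T R).obj F ≅ H) := by
  have := hasColimitsOfShape_discrete_of_small.{v} T ℕ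
  have := hH.isLinearPresheaf
  have hG' := hG.toIsGeneratingSequence
  obtain ⟨S, x, hx, hsurj, hinj⟩ := hH.exists_covering_sequence hG' hfin hHf
    (U := fun n => (shiftedSlice G n).inverseImage (compacts T).ι)
    fun n => (hG.finite_shiftedSlice n).preimage (f := ObjectProperty.FullSubcategory.obj)
      fun _ _ _ _ => ObjectProperty.FullSubcategory.ext
  obtain ⟨F, π, δ, h⟩ := distinguished_cocone_triangle (telescope (S ⋙ (compacts T).ι))
  obtain ⟨φ, hφ⟩ := exists_comparison h hx
  have isIsoAt (X : T) (hX : slice G Set.univ X) (a : ℤ) : IsIsoAt φ (X⟦a⟧) := by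
    have hXc : compacts T X := hG'.generates ▸ slice_le_small G _ X hX
    obtain ⟨l, hl⟩ := exists_forall_shiftedSlice hX a
    let K : (compacts T).FullSubcategory := ⟨X⟦a⟧, (compacts T).le_shift a _ hXc⟩
    exact ⟨K.property, isIso_comparison_app h hφ (l := l)
      (fun y => ⟨_, hsurj l K (hl l le_rfl) y⟩) fun n hn => hinj n K (hl n hn)⟩
  have := hG'.isIso_of_isIsoAt_shift (restrictedYoneda_isCohomological R F) hH isIsoAt
  exact ⟨F, .hocolim h fun n => (S.obj n).2, ⟨asIso φ⟩⟩

lemma IsCohomological.of_iso (hH : IsCohomological H) (e : H ≅ H') : IsCohomological H' where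
  additive := by
    have := hH.additive
    exact Functor.additive_of_iso e
  map_smul f r := by
    rw [← cancel_epi (e.hom.app _), ← e.hom.naturality, hH.map_smul, Linear.comp_smul,
      ← e.hom.naturality, Linear.smul_comp]
  exact X Y Z a b c h :=
    Function.Exact.of_ladder_linearEquiv_of_exact
      (e₁ := (e.app _).toLinearEquiv) (e₂ := (e.app _).toLinearEquiv)
      (e₃ := (e.app _).toLinearEquiv)
      (congrArg ModuleCat.Hom.hom (e.hom.naturality b.op).symm)
      (congrArg ModuleCat.Hom.hom (e.hom.naturality a.op).symm) (hH.exact X Y Z a b c h)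

lemma IsGFinite.of_iso (hH : IsGFinite G H) (e : H ≅ H') : IsGFinite G H' where
  toIsCohomological := hH.toIsCohomological.of_iso e
  finite K := by
    have := hH.finite K
    exact Module.Finite.equiv (e.app (op K)).toLinearEquiv
  bounded := hH.bounded.imp fun N hN i hi K hK => by
    have := hN i hi K hK
    exact (e.app (op K)).toLinearEquiv.symm.injective.subsingleton

lemma eq_of_comp_eq_of_metricR {F F' E D : T} {n : ℤ} {a : E ⟶ F} {b : F ⟶ D}
    {c : D ⟶ E⟦(1 : ℤ)⟧} (h : Triangle.mk a b c ∈ distTriang T) (hD : metricR G n D)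
    (hF' : (metricM G n).rightOrthogonal F') {f g : F ⟶ F'} (hfg : a ≫ f = a ≫ g) : f = g := by
  obtain ⟨t, ht⟩ : ∃ t : D ⟶ F', f - g = b ≫ t := Triangle.yoneda_exact₂ _ h (f - g)
    (show a ≫ (f - g) = 0 by rw [Preadditive.comp_sub, hfg, sub_self])
  rw [← sub_eq_zero, ht, hD t hF', comp_zero]

variable (R) in
lemma restrictedYoneda_map_injective {F F' : T} (hF : closureCompacts G F) {n : ℤ}
    (hF' : (metricM G n).rightOrthogonal F') :
    Function.Injective ((restrictedYoneda T R).map : (F ⟶ F') → _) := by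
  intro f g hfg
  obtain ⟨E, D, a, b, c, h, hE, hD⟩ := hF n
  exact eq_of_comp_eq_of_metricR h hD hF'
    (ConcreteCategory.congr_hom (NatTrans.congr_app hfg (op ⟨E, hE⟩)) a)

/-- A map out of the compact part of `F` at the level `N` extends to `F`, as the cone and its
desuspension are orthogonal to `F'`. -/
lemma IsGeneratingSequence.exists_hom_eq_app (hG : IsGeneratingSequence G) {F F' : T}
    (hF : closureCompacts G F) {n N : ℤ} (hN : n + 1 ≤ N)
    (hF' : (metricM G n).rightOrthogonal F')
    (φ : (restrictedYoneda T R).obj F ⟶ (restrictedYoneda T R).obj F') :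
    ∃ f : F ⟶ F', ∀ K : (compacts T).FullSubcategory,
      (∀ X, metricR G N X → ∀ u : K.obj ⟶ X, u = 0) → ∀ k : K.obj ⟶ F,
        ((restrictedYoneda T R).map f).app (op K) k = φ.app (op K) k := by
  obtain ⟨E, D, a, b, c, h, hE, hD⟩ := hF N
  have hD' : metricR G n (D⟦(-1 : ℤ)⟧) := hG.metricR_shift (by simpa using hN) hD
  let fa : E ⟶ F' := φ.app (op ⟨E, hE⟩) a
  obtain ⟨f, hf⟩ : ∃ f : F ⟶ F', fa = a ≫ f :=
    Triangle.yoneda_exact₂ _ (inv_rot_of_distTriang _ h) fa (hD' _ hF')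
  refine ⟨f, fun K hK k => ?_⟩
  obtain ⟨s, rfl⟩ : ∃ s : K.obj ⟶ E, k = s ≫ a := Triangle.coyoneda_exact₂ _ h k (hK D hD _)
  let s' : K ⟶ ⟨E, hE⟩ := ObjectProperty.homMk s
  have comp_eq : (s ≫ a) ≫ f = s ≫ fa := by rw [hf, Category.assoc]
  exact comp_eq.trans (ConcreteCategory.congr_hom (φ.naturality s'.op) a).symm

namespace IsQuasiapproximableWith

variable {M : ℤ → ObjectProperty T} {A : ℕ} (h : IsQuasiapproximableWith G M A)

include h

lemma restrictedYoneda_map_surjective {F F' : T} (hF : closureCompacts G F) {n : ℤ}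
    (hF' : (metricM G n).rightOrthogonal F') :
    Function.Surjective ((restrictedYoneda T R).map : (F ⟶ F') → _) := by
  intro φ
  obtain ⟨E, D, a, b, c, hT, hE, hD⟩ := hF n
  obtain ⟨N, hN⟩ := h.eventually_hom_eq_zero hE
  have exists_hom (m : ℤ) :=
    h.isGeneratingSequence.exists_hom_eq_app hF (le_max_left (n + 1) m) hF' φ
  obtain ⟨f, hf⟩ := exists_hom N
  refine ⟨f, ?_⟩
  ext K k
  obtain ⟨N', hN'⟩ := h.eventually_hom_eq_zero K.unop.2
  obtain ⟨f', hf'⟩ := exists_hom (max N N')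
  have f_eq : f = f' := eq_of_comp_eq_of_metricR hT hD hF'
    ((hf ⟨E, hE⟩ (hN _ (by lia)) a).trans (hf' ⟨E, hE⟩ (hN _ (by lia)) a).symm)
  rw [f_eq]
  exact hf' K.unop (hN' _ (by lia)) k

variable (hfin : compacts T ≤ HomFiniteFrom R (compacts T))

include hfin

lemma restrictedYoneda_isGFinite {F : T} (hF : boundedClosure G F) :
    IsGFinite G ((restrictedYoneda T R).obj F) where
  toIsCohomological := restrictedYoneda_isCohomological R F
  finite K := h.closureCompacts_le_homFiniteFrom hfin F hF.1 K.obj K.2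
  bounded := by
    obtain ⟨hF, n, hn⟩ := hF
    obtain ⟨i, hi⟩ := h.exists_metric hF
    refine ⟨|n| + |A - i|, fun j hj K hK => subsingleton_of_forall_eq (0 : K.obj ⟶ F) fun f => ?_⟩
    rcases le_total 0 j with hj₀ | hj₀
    · exact h.orth j i (by grind) F hi f hK
    · exact (small_rightOrthogonal_iff G _ F).1 hn j (by grind) f hK

lemma exists_representing_boundedClosure [IsTriangulated T] [HasCoproducts.{v} T]
    [IsNoetherianRing R] (hH : IsGFinite G H) :
    ∃ F, boundedClosure G F ∧ Nonempty ((restrictedYoneda T R).obj F ≅ H) := by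
  obtain ⟨F, hph, ⟨e⟩⟩ := hH.exists_representing h.generating hfin hH.finite
  have hF := hH.of_iso e.symm
  obtain ⟨N, hN⟩ := hF.bounded
  have orthogonal (j : ℤ) (hj : N ≤ |j|) : (G j).rightOrthogonal F := fun K f hK =>
    let K' : (compacts T).FullSubcategory := ⟨K, h.generating.le_compacts j K hK⟩
    have := hN j hj K' hK
    Subsingleton.elim (α := ((restrictedYoneda T R).obj F).obj (op K')) f 0
  refine ⟨F, ⟨h.closureCompacts_of_bounded hfin (N := N) ?_ (fun K hK => hF.finite ⟨K, hK⟩) hph,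
    N, ?_⟩, ⟨e⟩⟩
  · exact (small_rightOrthogonal_iff G _ F).2 fun j hj => orthogonal j (by grind)
  · exact (small_rightOrthogonal_iff G _ F).2 fun j hj => orthogonal j (by grind)

end IsQuasiapproximableWith

end Representability

end GApprox

theorem mainTheorem2 {T : Type u} [Category.{v} T] [HasZeroObject T] [HasShift T ℤ]
    [Preadditive T] [∀ n : ℤ, (shiftFunctor T n).Additive] [Pretriangulated T] [IsTriangulated T]
    (R : Type w) [CommRing R] [IsNoetherianRing R] [Linear R T]
    (G : ℤ → ObjectProperty T) (hG : GApprox.IsFiniteGeneratingSequence G)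
    (hT : GApprox.IsQuasiapproximable G)
    (hfin : ∀ (m n : ℤ) (X Y : T), G m X → G n Y → Module.Finite R (X ⟶ Y)) :
    (∀ H : (GApprox.compacts T).FullSubcategoryᵒᵖ ⥤ ModuleCat.{v} R,
      (GApprox.restrictedYonedaBounded R G).essImage H ↔ GApprox.IsGFinite G H) ∧
    (GApprox.restrictedYonedaBounded R G).Full ∧
    (GApprox.restrictedYonedaBounded R G).Faithful := by
  obtain ⟨M, A, hA, hM, hpre, horth, happrox⟩ := hT.exists_metric
  have h : GApprox.IsQuasiapproximableWith G M A := ⟨hG, hM, hA, hpre, horth, happrox⟩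
  have := hT.compactlyGenerated.hasCoproducts
  have hfin' := hG.compacts_le_homFiniteFrom (R := R)
    fun X Y ⟨m, _, hX⟩ ⟨n, _, hY⟩ => hfin m n X Y hX hY
  refine ⟨fun H => ⟨?_, fun hH => ?_⟩, ⟨fun {F F'} φ => ?_⟩, ⟨fun {F F'} f g hfg => ?_⟩⟩
  · rintro ⟨F, ⟨e⟩⟩
    exact (h.restrictedYoneda_isGFinite hfin' F.2).of_iso e
  · obtain ⟨F, hF, ⟨e⟩⟩ := h.exists_representing_boundedClosure hfin' hH
    exact ⟨⟨F, hF⟩, ⟨e⟩⟩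
  · obtain ⟨n, hn⟩ := F'.2.2
    obtain ⟨f, hf⟩ := h.restrictedYoneda_map_surjective F.2.1 hn φ
    exact ⟨ObjectProperty.homMk f, hf⟩
  · obtain ⟨n, hn⟩ := F'.2.2
    ext
    exact GApprox.restrictedYoneda_map_injective R F.2.1 hn hfg
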